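/- Let $E$ and $F$ be Polish spaces with their Borel $\sigma$-fields, let $d$ be a metric on $E$ inducing its topology, and let $\mathcal P(E)$ be the space of Borel probability measures on $E$ with the topology of weak convergence. Let $P:E\times\mathcal B(E)\to[0,1]$ and $\Phi:E\times\mathcal B(F)\to[0,1]$ be transition probability kernels and let $\mu\in\mathcal P(E)$. Assume: (a) (Nondegeneracy) there are a $\sigma$-finite measure $\varphi$ on $F$ and a measurable function $\Upsilon:E\times F\to(0,\infty)$ with $\Phi(x,A)=\int_A\Upsilon(x,y)\,\varphi(dy)$ for all $x\in E$, $A\in\mathcal B(F)$; (b) (Continuity) $P$ is Feller, i.e. $x\mapsto P(x,\cdot)\in\mathcal P(E)$ is continuous, and for every $y\in F$ the map $x\mapsto\Upsilon(x,y)$ is continuous and bounded. For $\pi\in\mathcal P(E)$ and $y\in F$ put $\pi P(A)=\int P(x,A)\,\pi(dx)$ and $\mathsf U(y,\pi)(A)=\int_A\Upsilon(x,y)\,\pi(dx)\big/\int\Upsilon(x,y)\,\pi(dx)$. For $N\ge1$ and $\rho\in\mathcal P(E)$ let $\mathsf R_N(\rho,\cdot)$ be the law of $\frac1N\sum_{i=1}^N\delta_{X^i}$,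 where $X^1,\dots,X^N$ are i.i.d. with law $\rho$. Define probability kernels $\mathsf\Pi,\mathsf\Pi_N$ from $E\times\mathcal P(E)$ to itself and probability measures $M,M_N$ on $E\times\mathcal P(E)$ by $$\int f\,d\mathsf\Pi(x,\pi,\cdot)=\int f(x',\mathsf U(y,\pi P))\,\Upsilon(x',y)\,\varphi(dy)\,P(x,dx'),\qquad \int f\,dM=\int f(x,\mathsf U(y,\mu))\,\Upsilon(x,y)\,\varphi(dy)\,\mu(dx),$$ $$\int f\,d\mathsf\Pi_N(x,\pi,\cdot)=\int f(x',\mathsf U(y,\pi'))\,\mathsf R_N(\pi P,d\pi')\,\Upsilon(x',y)\,\varphi(dy)\,P(x,dx'),$$ $$\int f\,dM_N=\int f(x,\mathsf U(y,\pi))\,\mathsf R_N(\mu,d\pi)\,\Upsilon(x,y)\,\varphi(dy)\,\mu(dx).$$ Then: (1) for every bounded continuous $f:E\times\mathcal P(E)\to\mathbb R$, whenever $x_N\to x$ in $E$ and $\nu_N\to\nu$ in $\mathcal P(E)$, $\int f\,d\mathsf\Pi_N(x_N,\nu_N,\cdot)\to\int f\,d\mathsf\Pi(x,\nu,\cdot)$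 as $N\to\infty$; (2) $M_N\to M$ weakly as $N\to\infty$; (3) let $(X_k,Y_k)_{k\ge0}$ be a hidden Markov model on a probability space $(\Omega,\mathcal F,\mathbf P)$, i.e. $(X_k)$ is a Markov chain with initial law $\mu$ and transition kernel $P$ and, conditionally on $(X_k)_{k\ge0}$, the $Y_k$ are independent with laws $\Phi(X_k,\cdot)$. Let $\pi_0=\mathsf U(Y_0,\mu)$, $\pi_{k+1}=\mathsf U(Y_{k+1},\pi_kP)$ be the nonlinear filter. For every $N\ge1$ let $(\pi^N_k)_{k\ge0}$ be a bootstrap particle filter with $N$ particles on $\Omega$: given $(X_j,Y_j)_{j\ge0}$, $\pi^N_0$ has conditional law $\mathsf R_N(\mu,\mathsf U(Y_0,\cdot)^{-1}(\cdot))$, and given $(X_j,Y_j)_{j\ge0}$ and $\pi_0^N,\dots,\pi_k^N$, $\pi^N_{k+1}$ has conditional law $\mathsf R_N(\pi_k^NP,\mathsf U(Y_{k+1},\cdot)^{-1}(\cdot))$. With $\|\nu-\nu'\|_{\rm BL}=\sup\{|\int f\,d\nu-\int f\,d\nu'|:\ |f|\le1,\ f\text{ is }1\text{-Lipschitz for }d\}$,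 the random variables $\|\pi_k^N-\pi_k\|_{\rm BL}$ are integrable and $$\mathbf E\,\|\pi_k^N-\pi_k\|_{\rm BL}\xrightarrow[N\to\infty]{}0\qquad\text{for every fixed }k\ge0.$$ -/

import Mathlib

open MeasureTheory ProbabilityTheory Filter Topology
open scoped ENNReal NNReal BoundedContinuousFunction

noncomputable section

namespace ParticleFilter

variable {E F Ω : Type*}

/-! ### Assumptions on the hidden Markov model -/

/-- Nondegeneracy: `Φ(x, dy) = Υ(x, y) φ(dy)` with a strictly positive, jointly measurable
density `Υ`. (The `σ`-finiteness of `φ` is the type class `SigmaFinite φ`.) -/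
structure Nondegenerate [MeasurableSpace E] [MeasurableSpace F]
    (Φ : Kernel E F) (φ : Measure F) (Υ : E → F → ℝ) : Prop where
  measurable : Measurable (Function.uncurry Υ)
  pos : ∀ x y, 0 < Υ x y
  density : ∀ (x : E) (A : Set F), MeasurableSet A →
    Φ x A = ∫⁻ y in A, ENNReal.ofReal (Υ x y) ∂φ

/-- The probability measure `P(x, ·)`. -/
def transition [MeasurableSpace E] (P : Kernel E E) [IsMarkovKernel P] (x : E) :
    ProbabilityMeasure E :=
  ⟨P x, inferInstance⟩

/-- Continuity: `P` is Feller, i.e. `x ↦ P(x, ·)` is continuous for the weak topology, and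
`x ↦ Υ(x, y)` is continuous and bounded for every `y`. -/
structure ContinuousModel [TopologicalSpace E] [MeasurableSpace E] [OpensMeasurableSpace E]
    (P : Kernel E E) [IsMarkovKernel P] (Υ : E → F → ℝ) : Prop where
  feller : Continuous (transition P)
  continuous_density : ∀ y, Continuous (fun x => Υ x y)
  bounded_density : ∀ y, ∃ C : ℝ, ∀ x, |Υ x y| ≤ C

/-! ### Prediction, update, sampling -/

/-- The prediction step `π ↦ πP`, where `πP(A) = ∫ P(x, A) π(dx)`. -/
def predict [MeasurableSpace E] (P : Kernel E E) [IsMarkovKernel P] (π : ProbabilityMeasure E) :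
    ProbabilityMeasure E :=
  ⟨(π : Measure E).bind P, inferInstance⟩

/-- The measure `A ↦ ∫_A Υ(x, y) π(dx) / ∫ Υ(x, y) π(dx)`. -/
def updateMeasure [MeasurableSpace E] (Υ : E → F → ℝ) (y : F) (π : ProbabilityMeasure E) :
    Measure E :=
  (∫⁻ x, ENNReal.ofReal (Υ x y) ∂(π : Measure E))⁻¹ •
    (π : Measure E).withDensity (fun x => ENNReal.ofReal (Υ x y))

open Classical in
/-- The update map `U(y, π)`, with `U(y, π)(A) = ∫_A Υ(x, y) π(dx) / ∫ Υ(x, y) π(dx)`. When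
`Υ(·, y)` is measurable, strictly positive and bounded, the right-hand side is a probability
measure (`isProbabilityMeasure_updateMeasure`), so that the second branch is not used. -/
def update [MeasurableSpace E] (Υ : E → F → ℝ) (y : F) (π : ProbabilityMeasure E) :
    ProbabilityMeasure E :=
  if h : IsProbabilityMeasure (updateMeasure Υ y π) then ⟨updateMeasure Υ y π, h⟩ else π

/-- The empirical measure `(1/N) ∑ᵢ δ_{xᵢ}`. -/
def empirical [MeasurableSpace E] (N : ℕ+) (x : Fin N → E) : ProbabilityMeasure E :=
  ⟨(N : ℝ≥0∞)⁻¹ • ∑ i, Measure.dirac (x i), ⟨by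
    have h0 : ((N : ℕ) : ℝ≥0∞) ≠ 0 := by simp
    simp [ENNReal.inv_mul_cancel h0 (ENNReal.natCast_ne_top _)]⟩⟩

/-- The sampling kernel `R_N(ρ, ·)`: the law of the empirical measure of `N` independent samples
from `ρ`. -/
def sampling [MeasurableSpace E] (N : ℕ+) (ρ : ProbabilityMeasure E) :
    Measure (ProbabilityMeasure E) :=
  (Measure.pi (fun _ : Fin N => (ρ : Measure E))).map (empirical N)

/-! ### Transition kernels and initial measures of the exact and the approximate filter -/

section Kernels

variable [MeasurableSpace E] [MeasurableSpace F]

/-- The measure `Υ(x, y) φ(dy) ν(dx)` on `E × F`. -/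
def obsMeasure (φ : Measure F) (Υ : E → F → ℝ) (ν : Measure E) : Measure (E × F) :=
  (ν.prod φ).withDensity (fun p => ENNReal.ofReal (Υ p.1 p.2))

/-- The kernel `Π` of the exact filter:
`∫ f dΠ(x, π, ·) = ∫ f(x', U(y, πP)) Υ(x', y) φ(dy) P(x, dx')`. -/
def exactKernel (P : Kernel E E) [IsMarkovKernel P] (φ : Measure F) (Υ : E → F → ℝ)
    (x : E) (π : ProbabilityMeasure E) : Measure (E × ProbabilityMeasure E) :=
  (obsMeasure φ Υ (P x)).map (fun p => (p.1, update Υ p.2 (predict P π)))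

/-- The initial measure `M` of the exact filter:
`∫ f dM = ∫ f(x, U(y, μ)) Υ(x, y) φ(dy) μ(dx)`. -/
def exactInit (μ : ProbabilityMeasure E) (φ : Measure F) (Υ : E → F → ℝ) :
    Measure (E × ProbabilityMeasure E) :=
  (obsMeasure φ Υ (μ : Measure E)).map (fun p => (p.1, update Υ p.2 μ))

/-- The kernel `Π_N` of the bootstrap particle filter:
`∫ f dΠ_N(x, π, ·) = ∫ f(x', U(y, π')) R_N(πP, dπ') Υ(x', y) φ(dy) P(x, dx')`. -/
def bootstrapKernel (P : Kernel E E) [IsMarkovKernel P] (φ : Measure F) (Υ : E → F → ℝ)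
    (N : ℕ+) (x : E) (π : ProbabilityMeasure E) : Measure (E × ProbabilityMeasure E) :=
  ((obsMeasure φ Υ (P x)).prod (sampling N (predict P π))).map
    (fun p => (p.1.1, update Υ p.1.2 p.2))

/-- The initial measure `M_N` of the bootstrap particle filter:
`∫ f dM_N = ∫ f(x, U(y, π)) R_N(μ, dπ) Υ(x, y) φ(dy) μ(dx)`. -/
def bootstrapInit (μ : ProbabilityMeasure E) (φ : Measure F) (Υ : E → F → ℝ) (N : ℕ+) :
    Measure (E × ProbabilityMeasure E) :=
  ((obsMeasure φ Υ (μ : Measure E)).prod (sampling N μ)).map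
    (fun p => (p.1.1, update Υ p.1.2 p.2))

end Kernels

/-! ### The processes -/

section Processes

variable [MeasurableSpace E] [MeasurableSpace F] [MeasurableSpace Ω]

/-- `(X_n, Y_n)` is a hidden Markov model under `Pr` with initial measure `μ`, transition kernel
`P` and observation kernel `Φ`: `X` is a Markov chain with initial law `μ` and transition kernel
`P`, and given the whole path of `X` the `Y_n` are independent with laws `Φ(X_n, ·)`. -/
structure IsHiddenMarkovModel (Pr : Measure Ω) (μ : ProbabilityMeasure E) (P : Kernel E E)
    (Φ : Kernel E F) (X : ℕ → Ω → E) (Y : ℕ → Ω → F) : Prop where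
  measurable_signal : ∀ n, Measurable (X n)
  measurable_obs : ∀ n, Measurable (Y n)
  init : Pr.map (X 0) = (μ : Measure E)
  markov : ∀ (n : ℕ) (A : Set E), MeasurableSet A →
    Pr⟦X (n + 1) ⁻¹' A | ⨆ j ∈ Finset.range (n + 1), MeasurableSpace.comap (X j) inferInstance⟧
      =ᵐ[Pr] fun ω => (P (X n ω)).real A
  obs : ∀ (n : ℕ) (A : ℕ → Set F), (∀ j, MeasurableSet (A j)) →
    Pr⟦⋂ j ∈ Finset.range (n + 1), Y j ⁻¹' A j | ⨆ j, MeasurableSpace.comap (X j) inferInstance⟧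
      =ᵐ[Pr] fun ω => ∏ j ∈ Finset.range (n + 1), (Φ (X j ω)).real (A j)

/-- The nonlinear filter `π_k(y_0, …, y_k)` along an observation sequence `y`:
`π_0 = U(y_0, μ)` and `π_{k+1} = U(y_{k+1}, π_k P)`. -/
def nonlinearFilter (μ : ProbabilityMeasure E) (P : Kernel E E) [IsMarkovKernel P]
    (Υ : E → F → ℝ) (y : ℕ → F) : ℕ → ProbabilityMeasure E
  | 0 => update Υ (y 0) μ
  | k + 1 => update Υ (y (k + 1)) (predict P (nonlinearFilter μ P Υ y k))

/-- `π_0, π_1, …` is a bootstrap particle filter with `N` particles for `(X, Y)`: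
given `(X_j, Y_j)_{j ≥ 0}`, `π_0` is `U(Y_0, ·)` applied to a fresh sample from `R_N(μ, ·)`; given
`(X_j, Y_j)_{j ≥ 0}` and `π_0, …, π_k`, `π_{k+1}` is `U(Y_{k+1}, ·)` applied to a fresh sample from
`R_N(π_k P, ·)`. -/
structure IsBootstrapFilter (Pr : Measure Ω) (μ : ProbabilityMeasure E) (P : Kernel E E)
    [IsMarkovKernel P] (Υ : E → F → ℝ) (X : ℕ → Ω → E) (Y : ℕ → Ω → F) (N : ℕ+)
    (π : ℕ → Ω → ProbabilityMeasure E) : Prop where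
  measurable : ∀ k, Measurable (π k)
  init : ∀ A : Set (ProbabilityMeasure E), MeasurableSet A →
    Pr⟦π 0 ⁻¹' A | ⨆ j, (MeasurableSpace.comap (X j) inferInstance ⊔
        MeasurableSpace.comap (Y j) inferInstance)⟧
      =ᵐ[Pr] fun ω => ((sampling N μ).map (update Υ (Y 0 ω))).real A
  step : ∀ (k : ℕ) (A : Set (ProbabilityMeasure E)), MeasurableSet A →
    Pr⟦π (k + 1) ⁻¹' A | (⨆ j, (MeasurableSpace.comap (X j) inferInstance ⊔
        MeasurableSpace.comap (Y j) inferInstance)) ⊔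
        ⨆ j ∈ Finset.range (k + 1), MeasurableSpace.comap (π j) inferInstance⟧
      =ᵐ[Pr] fun ω =>
        ((sampling N (predict P (π k ω))).map (update Υ (Y (k + 1) ω))).real A

end Processes

/-- The dual bounded-Lipschitz distance: the supremum of `|∫ f dν - ∫ f dν'|` over all `f` with
`|f| ≤ 1` and Lipschitz constant at most `1`. -/
def blDist [PseudoMetricSpace E] [MeasurableSpace E] (ν ν' : ProbabilityMeasure E) : ℝ :=
  ⨆ f : {f : E → ℝ // (∀ x, |f x| ≤ 1) ∧ LipschitzWith 1 f},
    |∫ x, f.1 x ∂(ν : Measure E) - ∫ x, f.1 x ∂(ν' : Measure E)|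

/-! ### The measures above are well defined -/

section WellDefined

theorem isProbabilityMeasure_updateMeasure [MeasurableSpace E] {Υ : E → F → ℝ} {y : F}
    (hm : Measurable (fun x => Υ x y)) (hpos : ∀ x, 0 < Υ x y) (hb : ∃ C : ℝ, ∀ x, |Υ x y| ≤ C)
    (π : ProbabilityMeasure E) : IsProbabilityMeasure (updateMeasure Υ y π) := by
  obtain ⟨C, hC⟩ := hb
  have h0 : (∫⁻ x, ENNReal.ofReal (Υ x y) ∂(π : Measure E)) ≠ 0 := by
    rw [Ne, lintegral_eq_zero_iff hm.ennreal_ofReal]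
    intro h
    obtain ⟨x, hx⟩ := h.exists
    have h1 := hpos x
    simp only [Pi.zero_apply, ENNReal.ofReal_eq_zero] at hx
    linarith
  have ht : (∫⁻ x, ENNReal.ofReal (Υ x y) ∂(π : Measure E)) ≠ ∞ := by
    refine ne_top_of_le_ne_top (ENNReal.ofReal_ne_top (r := C)) ?_
    calc (∫⁻ x, ENNReal.ofReal (Υ x y) ∂(π : Measure E))
        ≤ ∫⁻ _, ENNReal.ofReal C ∂(π : Measure E) :=
          lintegral_mono fun x => ENNReal.ofReal_le_ofReal ((le_abs_self _).trans (hC x))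
      _ = ENNReal.ofReal C := by simp
  exact ⟨by simp [updateMeasure, ENNReal.inv_mul_cancel h0 ht]⟩

theorem measurable_empirical [MeasurableSpace E] (N : ℕ+) : Measurable (empirical (E := E) N) := by
  refine Measurable.subtype_mk (Measure.measurable_of_measurable_coe _ fun s hs => ?_)
  simp only [Measure.smul_apply, Measure.coe_finsetSum, Finset.sum_apply, smul_eq_mul,
    Measure.dirac_apply' _ hs]
  refine Measurable.const_mul (Finset.measurable_sum _ fun i _ => ?_) _
  exact (measurable_one.indicator hs).comp (measurable_pi_apply i)

theorem measurable_update [MeasurableSpace E] [MeasurableSpace F] {Υ : E → F → ℝ}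
    (hm : Measurable (Function.uncurry Υ))
    (hpos : ∀ x y, 0 < Υ x y) (hb : ∀ y, ∃ C : ℝ, ∀ x, |Υ x y| ≤ C) :
    Measurable (fun p : F × ProbabilityMeasure E => update Υ p.1 p.2) := by
  have hp : ∀ (y : F) (π : ProbabilityMeasure E), IsProbabilityMeasure (updateMeasure Υ y π) :=
    fun y π => isProbabilityMeasure_updateMeasure
      (Υ := Υ) (y := y) (hm.comp (measurable_id.prodMk measurable_const))
      (fun x => hpos x y) (hb y) π
  have he : (fun p : F × ProbabilityMeasure E => update Υ p.1 p.2) =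
      fun p => ⟨updateMeasure Υ p.1 p.2, hp p.1 p.2⟩ := by
    funext p
    exact dif_pos (hp p.1 p.2)
  rw [he]
  refine Measurable.subtype_mk (Measure.measurable_of_measurable_coe _ fun s hs => ?_)
  let κ : Kernel (F × ProbabilityMeasure E) E :=
    ⟨fun p => (p.2 : Measure E), measurable_subtype_coe.comp measurable_snd⟩
  have : IsMarkovKernel κ := ⟨fun p => inferInstanceAs (IsProbabilityMeasure (p.2 : Measure E))⟩
  have hf : Measurable (Function.uncurry fun (p : F × ProbabilityMeasure E) (x : E) =>
      ENNReal.ofReal (Υ x p.1)) :=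
    (hm.comp (measurable_snd.prodMk (measurable_fst.comp measurable_fst))).ennreal_ofReal
  have h1 := hf.lintegral_kernel_prod_right (κ := κ)
  have h2 := hf.setLIntegral_kernel_prod_right (κ := κ) hs
  simp only [updateMeasure, Measure.smul_apply, smul_eq_mul, withDensity_apply _ hs]
  exact h1.inv.mul h2

section

variable [MeasurableSpace E] [MeasurableSpace F] {φ : Measure F} [SigmaFinite φ]
  {Υ : E → F → ℝ} {Φ : Kernel E F} [IsMarkovKernel Φ]

theorem isProbabilityMeasure_obsMeasure (hnd : Nondegenerate Φ φ Υ) (ν : Measure E)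
    [IsProbabilityMeasure ν] : IsProbabilityMeasure (obsMeasure φ Υ ν) := by
  constructor
  have hm : Measurable (fun p : E × F => ENNReal.ofReal (Υ p.1 p.2)) :=
    hnd.measurable.ennreal_ofReal
  have h1 : ∀ x, ∫⁻ y, ENNReal.ofReal (Υ x y) ∂φ = 1 := fun x => by
    have h := hnd.density x Set.univ MeasurableSet.univ
    rw [measure_univ, Measure.restrict_univ] at h
    exact h.symm
  rw [obsMeasure, withDensity_apply _ MeasurableSet.univ, Measure.restrict_univ,
    lintegral_prod _ hm.aemeasurable]
  simp [h1]

theorem isProbabilityMeasure_sampling (N : ℕ+) (ρ : ProbabilityMeasure E) :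
    IsProbabilityMeasure (sampling N ρ) :=
  Measure.isProbabilityMeasure_map (measurable_empirical N).aemeasurable

variable [TopologicalSpace E] [OpensMeasurableSpace E] {P : Kernel E E} [IsMarkovKernel P]

theorem isProbabilityMeasure_exactKernel (hnd : Nondegenerate Φ φ Υ)
    (hc : ContinuousModel P Υ) (x : E) (π : ProbabilityMeasure E) :
    IsProbabilityMeasure (exactKernel P φ Υ x π) := by
  have := isProbabilityMeasure_obsMeasure hnd (P x)
  have hU := measurable_update hnd.measurable hnd.pos hc.bounded_density
  exact Measure.isProbabilityMeasure_map (measurable_fst.prodMk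
    (hU.comp (measurable_snd.prodMk measurable_const))).aemeasurable

theorem isProbabilityMeasure_exactInit (hnd : Nondegenerate Φ φ Υ)
    (hc : ContinuousModel P Υ) (μ : ProbabilityMeasure E) :
    IsProbabilityMeasure (exactInit μ φ Υ) := by
  have := isProbabilityMeasure_obsMeasure hnd (μ : Measure E)
  have hU := measurable_update hnd.measurable hnd.pos hc.bounded_density
  exact Measure.isProbabilityMeasure_map (measurable_fst.prodMk
    (hU.comp (measurable_snd.prodMk measurable_const))).aemeasurable

theorem isProbabilityMeasure_bootstrapKernel (hnd : Nondegenerate Φ φ Υ)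
    (hc : ContinuousModel P Υ) (N : ℕ+) (x : E) (π : ProbabilityMeasure E) :
    IsProbabilityMeasure (bootstrapKernel P φ Υ N x π) := by
  have := isProbabilityMeasure_obsMeasure hnd (P x)
  have := isProbabilityMeasure_sampling N (predict P π)
  have hU := measurable_update hnd.measurable hnd.pos hc.bounded_density
  exact Measure.isProbabilityMeasure_map ((measurable_fst.comp measurable_fst).prodMk
    (hU.comp ((measurable_snd.comp measurable_fst).prodMk measurable_snd))).aemeasurable

theorem isProbabilityMeasure_bootstrapInit (hnd : Nondegenerate Φ φ Υ)
    (hc : ContinuousModel P Υ) (μ : ProbabilityMeasure E) (N : ℕ+) :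
    IsProbabilityMeasure (bootstrapInit μ φ Υ N) := by
  have := isProbabilityMeasure_obsMeasure hnd (μ : Measure E)
  have := isProbabilityMeasure_sampling N μ
  have hU := measurable_update hnd.measurable hnd.pos hc.bounded_density
  exact Measure.isProbabilityMeasure_map ((measurable_fst.comp measurable_fst).prodMk
    (hU.comp ((measurable_snd.comp measurable_fst).prodMk measurable_snd))).aemeasurable

end

end WellDefined

end ParticleFilter

end

/-!
The bootstrap filter differs from the exact filter only by the sampling kernel `R_N(ρ, ·)`, and
sampling is asymptotically harmless: by Chebyshev's inequality the integral of a bounded function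
against the empirical measure of `N` samples from `ρ` has variance of order `1 / N`. Hence, whenever
`N → ∞` and `ρ_N → ρ` weakly, the laws `R_N(ρ_N, ·)` concentrate at `ρ`
(`tendsto_sampling_compl`, `tendsto_integral_sampling`). The prediction step is weakly continuous by
the Feller property, and the update step is so for each fixed observation `y`, because `Υ(·, y)` is
continuous, bounded and positive (`continuous_predict`, `continuous_update`).

For the convergence of `Π_N` and `M_N` the observation is integrated last. For a fixed observation
the remaining integrand is bounded and continuous in the signal and the sampled measure, and
products of weakly convergent measures converge weakly. The resulting functions of `y` are dominated
by multiples of the densities `∫ Υ(x, y) p_N(dx)` of the observation, which converge pointwise and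
all have integral one, so that a dominated convergence theorem with varying bounds applies
(`tendsto_integral_of_tendsto_integral_bound`, `tendsto_integral_obsMeasure_prod`).

The convergence of the particle filter is proved by induction on time. The conditional law of the
next particle filter given the past expresses the expected bounded Lipschitz distance as an
expectation of an integral against `R_N(π_k^N P, ·)`. Convergence in mean at time `k` yields almost
sure weak convergence along a subsequence of every sequence of particle numbers. There the
concentration of the sampling kernel makes the inner integrals tend to zero, and dominated
convergence concludes (`tendsto_integral_blDist_resample`, `tendsto_integral_blDist_bootstrap`).

Two facts about the space of probability measures on a separable metric space are needed throughout:
the `σ`-algebra generated by the evaluations contains the weakly open sets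
(`exists_countable_measurable_subbasis`), and the bounded Lipschitz distance metrizes weak
convergence (`tendsto_of_tendsto_blDist`, `tendsto_blDist_of_tendsto`).
-/

namespace ParticleFilter

/-! ### The weak topology has a countable subbasis of measurable sets -/

section WeakTopology

variable {E : Type*} [MeasurableSpace E]

theorem isOpen_setOf_lt_measure [TopologicalSpace E] [OpensMeasurableSpace E]
    [HasOuterApproxClosed E] {G : Set E} (hG : IsOpen G) (q : ℝ≥0∞) :
    IsOpen {Q : ProbabilityMeasure E | q < (Q : Measure E) G} := by
  refine isOpen_iff_mem_nhds.2 fun Q hQ => ?_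
  have h := ProbabilityMeasure.le_liminf_measure_open_of_tendsto
    (tendsto_id (x := 𝓝 Q)) hG
  exact eventually_lt_of_lt_liminf (lt_of_lt_of_le hQ h)

theorem measurableSet_setOf_lt_measure {G : Set E} (hG : MeasurableSet G) (q : ℝ≥0∞) :
    MeasurableSet {Q : ProbabilityMeasure E | q < (Q : Measure E) G} :=
  measurableSet_lt measurable_const ((Measure.measurable_coe hG).comp measurable_subtype_coe)

/-- The sets `{Q | q < Q G}`, with `q` rational and `G` a finite union of sets of a countable basis,
generate the weak topology: by the portmanteau theorem it is enough to bound `Q G` from below for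
open `G`, and every open set is an increasing union of such finite unions. -/
theorem exists_countable_measurable_subbasis [TopologicalSpace E] [SecondCountableTopology E]
    [OpensMeasurableSpace E] [HasOuterApproxClosed E] :
    ∃ S : Set (Set (ProbabilityMeasure E)), S.Countable ∧ (∀ s ∈ S, MeasurableSet s) ∧
      (inferInstance : TopologicalSpace (ProbabilityMeasure E)) =
        TopologicalSpace.generateFrom S := by
  obtain ⟨e, he⟩ : ∃ e : ℕ → Set E, TopologicalSpace.IsTopologicalBasis (Set.range e) := by
    obtain ⟨e, he⟩ := ((TopologicalSpace.countable_countableBasis E).insert ∅).exists_eq_range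
      (Set.insert_nonempty _ _)
    exact ⟨e, he ▸ (TopologicalSpace.isBasis_countableBasis E).insert_empty⟩
  have heo : ∀ n, IsOpen (e n) := fun n => he.isOpen ⟨n, rfl⟩
  have hVo : ∀ T : Finset ℕ, IsOpen (⋃ k ∈ T, e k) := fun T =>
    isOpen_biUnion fun k _ => heo k
  set W : Finset ℕ × ℚ → Set (ProbabilityMeasure E) := fun p =>
    {Q | ((Real.toNNReal p.2 : ℝ≥0) : ℝ≥0∞) < (Q : Measure E) (⋃ k ∈ p.1, e k)} with hW
  refine ⟨Set.range W, Set.countable_range W, ?_, ?_⟩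
  · rintro _ ⟨p, rfl⟩
    exact measurableSet_setOf_lt_measure (hVo p.1).measurableSet _
  refine le_antisymm (le_generateFrom ?_) ?_
  · rintro _ ⟨p, rfl⟩
    exact isOpen_setOf_lt_measure (hVo p.1) _
  refine le_iff_nhds _ _ |>.2 fun Q => ?_
  let t := TopologicalSpace.generateFrom (Set.range W)
  have ht : @SecondCountableTopology _ t := @SecondCountableTopology.mk _ t
    ⟨Set.range W, Set.countable_range W, rfl⟩
  have : (@nhds _ t Q).IsCountablyGenerated :=
    @FirstCountableTopology.nhds_generated_countable _ t inferInstance Q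
  refine tendsto_of_forall_isOpen_le_liminf' (L := @nhds _ t Q) (μs := id) fun G hG => ?_
  classical
  -- exhaust `G` by finite unions of basic open sets
  set u : ℕ → Set E := fun n => if e n ⊆ G then e n else ∅ with hu
  have hGu : G = ⋃ n, u n := by
    refine Set.Subset.antisymm (fun x hx => ?_) (Set.iUnion_subset fun n => ?_)
    · obtain ⟨_, ⟨n, rfl⟩, hxn, hn⟩ := he.exists_subset_of_mem_open hx hG
      exact Set.mem_iUnion.2 ⟨n, by simpa [hu, hn] using hxn⟩
    · by_cases h : e n ⊆ G <;> simp [hu, h]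
  refine le_of_forall_lt fun c hc => ?_
  obtain ⟨c', hcc', hc'⟩ := exists_between hc
  refine hcc'.trans_le ?_
  rw [hGu, measure_iUnion_eq_iSup_accumulate] at hc'
  obtain ⟨n, hn⟩ := lt_iSup_iff.1 hc'
  obtain ⟨q, -, hq1, hq2⟩ := ENNReal.lt_iff_exists_rat_btwn.1 hn
  set T : Finset ℕ := (Finset.range (n + 1)).filter fun k => e k ⊆ G with hT
  have hTu : Set.accumulate u n = ⋃ k ∈ T, e k := by
    ext x
    simp only [Set.mem_accumulate, Set.mem_iUnion, hT, Finset.mem_filter, Finset.mem_range,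
      exists_prop, hu]
    refine exists_congr fun k => ?_
    by_cases h : e k ⊆ G <;> simp [h]
  have hTG : (⋃ k ∈ T, e k) ⊆ G := Set.iUnion₂_subset fun k hk => (Finset.mem_filter.1 hk).2
  have hmem : ∀ᶠ R in @nhds _ t Q, R ∈ W (T, q) := by
    have hRW : Q ∈ W (T, q) := by simpa [hW, hTu] using hq2
    exact @IsOpen.mem_nhds _ t Q (W (T, q))
      (TopologicalSpace.isOpen_generateFrom_of_mem (Set.mem_range_self _)) hRW
  refine le_liminf_of_le (by isBoundedDefault) (hmem.mono fun R hR => ?_)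
  exact hq1.le.trans ((le_of_lt hR).trans (measure_mono hTG))

instance secondCountableTopology_probabilityMeasure [TopologicalSpace E]
    [SecondCountableTopology E] [OpensMeasurableSpace E] [HasOuterApproxClosed E] :
    SecondCountableTopology (ProbabilityMeasure E) := by
  obtain ⟨S, hS, -, h⟩ := exists_countable_measurable_subbasis (E := E)
  exact ⟨S, hS, h⟩

/-- The `σ`-algebra generated by the evaluations `Q ↦ Q A` contains the weakly open sets, so that
continuous functions on `ProbabilityMeasure E` are measurable. -/
instance opensMeasurableSpace_probabilityMeasure [TopologicalSpace E]
    [SecondCountableTopology E] [OpensMeasurableSpace E] [HasOuterApproxClosed E] :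
    OpensMeasurableSpace (ProbabilityMeasure E) := by
  obtain ⟨S, -, hS, h⟩ := exists_countable_measurable_subbasis (E := E)
  refine ⟨?_⟩
  rw [borel_eq_generateFrom_of_subbasis h]
  exact MeasurableSpace.generateFrom_le hS

end WeakTopology

/-! ### The bounded Lipschitz distance metrizes weak convergence -/

section BoundedLipschitz

variable {E : Type*} [MeasurableSpace E]

theorem abs_integral_le_one {f : E → ℝ} (hf : ∀ x, |f x| ≤ 1) (ν : ProbabilityMeasure E) :
    |∫ x, f x ∂(ν : Measure E)| ≤ 1 := by
  simpa using norm_integral_le_of_norm_le_const (μ := (ν : Measure E)) (f := f) (ae_of_all _ hf)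

theorem abs_integral_sub_le_two {f : E → ℝ} (hf : ∀ x, |f x| ≤ 1) (ν ν' : ProbabilityMeasure E) :
    |∫ x, f x ∂(ν : Measure E) - ∫ x, f x ∂(ν' : Measure E)| ≤ 2 := by
  have h1 := abs_le.1 (abs_integral_le_one hf ν)
  have h2 := abs_le.1 (abs_integral_le_one hf ν')
  exact abs_le.2 ⟨by linarith, by linarith⟩

variable [PseudoMetricSpace E]

theorem bddAbove_range_blDist (ν ν' : ProbabilityMeasure E) :
    BddAbove (Set.range fun f : {f : E → ℝ // (∀ x, |f x| ≤ 1) ∧ LipschitzWith 1 f} =>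
      |∫ x, f.1 x ∂(ν : Measure E) - ∫ x, f.1 x ∂(ν' : Measure E)|) := by
  refine ⟨2, ?_⟩
  rintro _ ⟨f, rfl⟩
  exact abs_integral_sub_le_two f.2.1 ν ν'

theorem le_blDist {f : E → ℝ} (hf : ∀ x, |f x| ≤ 1) (hL : LipschitzWith 1 f)
    (ν ν' : ProbabilityMeasure E) :
    |∫ x, f x ∂(ν : Measure E) - ∫ x, f x ∂(ν' : Measure E)| ≤ blDist ν ν' :=
  le_ciSup (bddAbove_range_blDist ν ν') ⟨f, hf, hL⟩

theorem blDist_le {ν ν' : ProbabilityMeasure E} {c : ℝ}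
    (h : ∀ f : E → ℝ, (∀ x, |f x| ≤ 1) → LipschitzWith 1 f →
      |∫ x, f x ∂(ν : Measure E) - ∫ x, f x ∂(ν' : Measure E)| ≤ c) : blDist ν ν' ≤ c := by
  have : Nonempty {f : E → ℝ // (∀ x, |f x| ≤ 1) ∧ LipschitzWith 1 f} :=
    ⟨⟨fun _ => 0, by simp, LipschitzWith.const' 0⟩⟩
  exact ciSup_le fun f => h f.1 f.2.1 f.2.2

theorem blDist_nonneg (ν ν' : ProbabilityMeasure E) : 0 ≤ blDist ν ν' :=
  Real.iSup_nonneg fun _ => abs_nonneg _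

theorem blDist_le_two (ν ν' : ProbabilityMeasure E) : blDist ν ν' ≤ 2 :=
  blDist_le fun _ hf _ => abs_integral_sub_le_two hf ν ν'

theorem abs_blDist_le_two (ν ν' : ProbabilityMeasure E) : |blDist ν ν'| ≤ 2 := by
  rw [abs_of_nonneg (blDist_nonneg ν ν')]
  exact blDist_le_two ν ν'

theorem blDist_self (ν : ProbabilityMeasure E) : blDist ν ν = 0 :=
  le_antisymm (blDist_le fun f _ _ => by simp) (blDist_nonneg ν ν)

variable [OpensMeasurableSpace E]

theorem continuous_integral_of_bounded {X : Type*} [TopologicalSpace X] [MeasurableSpace X]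
    [OpensMeasurableSpace X] {f : X → ℝ} (hf : Continuous f) {C : ℝ} (hC : ∀ x, |f x| ≤ C) :
    Continuous fun ν : ProbabilityMeasure X => ∫ x, f x ∂(ν : Measure X) :=
  continuous_iff_continuousAt.2 fun ν =>
    (ProbabilityMeasure.tendsto_iff_forall_integral_tendsto.1 (tendsto_id (x := 𝓝 ν)))
      (BoundedContinuousFunction.ofNormedAddCommGroup f hf C hC)

/-- A supremum of continuous functions is lower semicontinuous, hence measurable, even though the
supremum runs over an uncountable family. -/
theorem measurable_blDist [SecondCountableTopology E] :
    Measurable fun p : ProbabilityMeasure E × ProbabilityMeasure E => blDist p.1 p.2 := by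
  refine LowerSemicontinuous.measurable ?_
  refine lowerSemicontinuous_ciSup (fun p => bddAbove_range_blDist p.1 p.2) fun f => ?_
  have hf := continuous_integral_of_bounded f.2.2.continuous f.2.1
  exact (((hf.comp continuous_fst).sub (hf.comp continuous_snd)).abs).lowerSemicontinuous

theorem tendsto_of_tendsto_blDist {ι : Type*} {l : Filter ι} [l.IsCountablyGenerated]
    {νs : ι → ProbabilityMeasure E} {ν : ProbabilityMeasure E}
    (h : Tendsto (fun i => blDist (νs i) ν) l (𝓝 0)) : Tendsto νs l (𝓝 ν) := by
  rw [tendsto_iff_forall_lipschitz_integral_tendsto]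
  rintro f ⟨C, hC⟩ ⟨L, hL⟩
  obtain ⟨x₀⟩ : Nonempty E := ν.nonempty
  -- a multiple of `f` belongs to the unit ball over which the supremum is taken
  set M : ℝ := |f x₀| + |C| + L + 1 with hM
  have hM0 : 0 < M := by positivity
  have hfM : ∀ x, |f x| ≤ M := fun x => by
    have h1 : |f x - f x₀| ≤ C := hC x x₀
    have h2 := abs_sub_abs_le_abs_sub (f x) (f x₀)
    have h3 := le_abs_self C
    have h4 : (0 : ℝ) ≤ L := L.2
    linarith
  set g : E → ℝ := fun x => M⁻¹ * f x with hg
  have hg1 : ∀ x, |g x| ≤ 1 := fun x => by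
    rw [hg, abs_mul, abs_of_pos (inv_pos.2 hM0), inv_mul_le_iff₀ hM0]
    simpa using hfM x
  have hgL : LipschitzWith 1 g := LipschitzWith.of_dist_le_mul fun x y => by
    have h1 := hL.dist_le_mul x y
    have h2 : (L : ℝ) ≤ M := by
      have h3 := abs_nonneg (f x₀)
      have h4 := abs_nonneg C
      linarith
    rw [Real.dist_eq] at h1 ⊢
    rw [hg, ← mul_sub, abs_mul, abs_of_pos (inv_pos.2 hM0), inv_mul_le_iff₀ hM0]
    simpa using h1.trans (mul_le_mul_of_nonneg_right h2 dist_nonneg)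
  have hbound : ∀ i, |∫ x, f x ∂(νs i : Measure E) - ∫ x, f x ∂(ν : Measure E)| ≤
      M * blDist (νs i) ν := fun i => by
    have h1 := le_blDist hg1 hgL (νs i) ν
    rw [hg, integral_const_mul, integral_const_mul, ← mul_sub, abs_mul,
      abs_of_pos (inv_pos.2 hM0), inv_mul_le_iff₀ hM0] at h1
    exact h1
  rw [tendsto_iff_dist_tendsto_zero]
  refine squeeze_zero (fun _ => dist_nonneg) hbound ?_
  simpa using h.const_mul M

/-- The `ε`-thickening of `{t ≤ f}` is contained in `{t ≤ f + ε}` for a `1`-Lipschitz `f`; the layer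
cake formula turns this inclusion into an estimate of the integrals. -/
theorem integral_le_add_of_levyProkhorovEDist_lt {ν ν' : Measure E} [IsProbabilityMeasure ν]
    [IsProbabilityMeasure ν'] {ε : ℝ} (hε : 0 < ε)
    (h : levyProkhorovEDist ν ν' < ENNReal.ofReal ε) {f : E → ℝ} (hf : ∀ x, |f x| ≤ 1)
    (hL : LipschitzWith 1 f) : ∫ x, f x ∂ν ≤ ∫ x, f x ∂ν' + 3 * ε := by
  have hint : ∀ κ : Measure E, IsProbabilityMeasure κ → Integrable f κ := fun κ _ =>
    .of_bound hL.continuous.aestronglyMeasurable 1 (ae_of_all _ hf)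
  -- the layer cake formula needs a nonnegative function
  set g : E →ᵇ ℝ := BoundedContinuousFunction.ofNormedAddCommGroup (fun x => f x + 1)
    (hL.continuous.add continuous_const) 2
    (fun x => by have := abs_le.1 (hf x); exact abs_le.2 ⟨by linarith, by linarith⟩) with hg
  have hg0 : ∀ x, 0 ≤ g x := fun x => by
    have := abs_le.1 (hf x)
    change 0 ≤ f x + 1
    linarith
  have hg2 : ‖g‖ ≤ 2 := BoundedContinuousFunction.norm_ofNormedAddCommGroup_le _ (by norm_num) _
  have h1 := BoundedContinuousFunction.integral_le_of_levyProkhorovEDist_lt ν ν' hε h g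
    (ae_of_all _ hg0)
  have hmeas : Measurable fun t : ℝ => ν'.real {x | t ≤ g x + ε} :=
    Antitone.measurable fun s t hst => measureReal_mono fun x hx => le_trans hst hx
  have hmeas' : Measurable fun t : ℝ => ν'.real (Metric.thickening ε {x | t ≤ g x}) :=
    Antitone.measurable fun s t hst => measureReal_mono
      (Metric.thickening_subset_of_subset _ fun x hx => le_trans hst hx)
  have hii : ∀ (M : ℝ) (F : ℝ → Set E), Measurable (fun t => ν'.real (F t)) →
      IntegrableOn (fun t => ν'.real (F t)) (Set.Ioc 0 M) := fun M F hF =>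
    Measure.integrableOn_of_bounded (M := 1) (by simp) hF.aestronglyMeasurable
      (ae_of_all _ fun t => by
        rw [Real.norm_of_nonneg measureReal_nonneg]; exact measureReal_le_one)
  have h2 : ∫ t in Set.Ioc 0 ‖g‖, ν'.real (Metric.thickening ε {x | t ≤ g x}) ≤
      ∫ t in Set.Ioc 0 ‖g‖, ν'.real {x | t ≤ g x + ε} := by
    refine integral_mono (hii _ _ hmeas') (hii _ _ hmeas) fun t => ?_
    refine measureReal_mono fun x hx => ?_
    obtain ⟨z, hz, hxz⟩ := Metric.mem_thickening_iff.1 hx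
    have h3 := hL.dist_le_mul x z
    rw [Real.dist_eq, NNReal.coe_one, one_mul] at h3
    have h4 := (abs_le.1 h3).1
    have h5 : t ≤ f z + 1 := hz
    change t ≤ f x + 1 + ε
    linarith
  have h3 : ∫ t in Set.Ioc 0 ‖g‖, ν'.real {x | t ≤ g x + ε} ≤
      ∫ t in Set.Ioc 0 (‖g‖ + ε), ν'.real {x | t ≤ g x + ε} :=
    setIntegral_mono_set (hii _ _ hmeas) (ae_of_all _ fun t => measureReal_nonneg)
      (LE.le.eventuallyLE (Set.Ioc_subset_Ioc_right (by linarith)))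
  have hgi : ∀ κ : Measure E, IsProbabilityMeasure κ → Integrable g κ := fun κ _ => g.integrable κ
  have h4 : ∫ x, (g x + ε) ∂ν' = ∫ t in Set.Ioc 0 (‖g‖ + ε), ν'.real {x | t ≤ g x + ε} := by
    refine Integrable.integral_eq_integral_Ioc_meas_le ((hgi ν' ‹_›).add (integrable_const ε))
      (ae_of_all _ fun x => add_nonneg (hg0 x) hε.le) (ae_of_all _ fun x => ?_)
    have := (le_abs_self _).trans (g.norm_coe_le_norm x)
    change g x + ε ≤ _
    linarith
  have h5 : ∀ κ : Measure E, IsProbabilityMeasure κ → ∫ x, g x ∂κ = ∫ x, f x ∂κ + 1 :=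
    fun κ hκ => by
      have : ∫ x, g x ∂κ = ∫ x, (f x + 1) ∂κ := rfl
      rw [this, integral_add (hint κ hκ) (integrable_const _)]
      simp
  rw [integral_add (hgi ν' ‹_›) (integrable_const ε), h5 ν' ‹_›] at h4
  rw [h5 ν ‹_›] at h1
  simp only [integral_const, probReal_univ, one_smul] at h4
  nlinarith

theorem tendsto_blDist_of_tendsto [TopologicalSpace.SeparableSpace E] {ι : Type*} {l : Filter ι}
    {νs : ι → ProbabilityMeasure E} {ν : ProbabilityMeasure E} (h : Tendsto νs l (𝓝 ν)) :
    Tendsto (fun i => blDist (νs i) ν) l (𝓝 0) := by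
  have h1 : Tendsto (fun i => levyProkhorovDist (νs i : Measure E) (ν : Measure E)) l (𝓝 0) := by
    have h2 := (LevyProkhorov.continuous_ofMeasure_probabilityMeasure.tendsto ν).comp h
    rw [tendsto_iff_dist_tendsto_zero] at h2
    exact h2
  refine tendsto_order.2 ⟨fun a ha => Eventually.of_forall fun i => ha.trans_le (blDist_nonneg _ _),
    fun a ha => ?_⟩
  have ha4 : 0 < a / 4 := by linarith
  filter_upwards [h1.eventually_lt_const ha4] with i hi
  have hi' : levyProkhorovEDist (νs i : Measure E) (ν : Measure E) < ENNReal.ofReal (a / 4) := by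
    rw [levyProkhorovDist] at hi
    exact (ENNReal.lt_ofReal_iff_toReal_lt (levyProkhorovEDist_ne_top _ _)).2 hi
  refine (blDist_le (c := 3 * (a / 4)) fun f hf hL => ?_).trans_lt (by linarith)
  have h3 := integral_le_add_of_levyProkhorovEDist_lt ha4 hi' hf hL
  rw [levyProkhorovEDist_comm] at hi'
  have h4 := integral_le_add_of_levyProkhorovEDist_lt ha4 hi' hf hL
  exact abs_le.2 ⟨by linarith, by linarith⟩

end BoundedLipschitz

/-! ### Prediction and update are weakly continuous -/

section Steps

variable {E F : Type*} [MeasurableSpace E]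

theorem continuous_predict [TopologicalSpace E] [OpensMeasurableSpace E] [SecondCountableTopology E]
    [TopologicalSpace.PseudoMetrizableSpace E]
    {P : Kernel E E} [IsMarkovKernel P] (hP : Continuous (transition P)) :
    Continuous (predict P) := by
  refine continuous_iff_continuousAt.2 fun π => ?_
  refine ProbabilityMeasure.tendsto_iff_forall_integral_tendsto.2 fun g => ?_
  have hbind : ∀ ν : ProbabilityMeasure E, ∫ x, g x ∂(predict P ν : Measure E) =
      ∫ x, ∫ z, g z ∂(P x) ∂(ν : Measure E) := fun ν =>
    Kernel.integral_comp (κ := Kernel.const Unit (ν : Measure E)) (η := P) (a := ())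
      (g.integrable ((predict P ν : ProbabilityMeasure E) : Measure E))
  simp only [hbind]
  have hg : Continuous fun x => ∫ z, g z ∂(P x) :=
    (continuous_integral_of_bounded g.continuous g.norm_coe_le_norm).comp hP
  refine (continuous_integral_of_bounded hg (C := ‖g‖) fun x => ?_).tendsto π
  simpa using norm_integral_le_of_norm_le_const (μ := P x) (f := g)
    (ae_of_all _ g.norm_coe_le_norm)

theorem measurable_predict (P : Kernel E E) [IsMarkovKernel P] : Measurable (predict P) :=
  Measurable.subtype_mk ((Measure.measurable_bind' P.measurable).comp measurable_subtype_coe)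

theorem coe_update {Υ : E → F → ℝ} {y : F} (hm : Measurable fun x => Υ x y)
    (hpos : ∀ x, 0 < Υ x y) (hb : ∃ C : ℝ, ∀ x, |Υ x y| ≤ C) (π : ProbabilityMeasure E) :
    (update Υ y π : Measure E) = updateMeasure Υ y π := by
  have h := isProbabilityMeasure_updateMeasure hm hpos hb π
  have he : update Υ y π = ⟨updateMeasure Υ y π, h⟩ := dif_pos h
  rw [he]
  rfl

theorem integrable_density {Υ : E → F → ℝ} {y : F} (hm : Measurable fun x => Υ x y)
    (hb : ∃ C : ℝ, ∀ x, |Υ x y| ≤ C) (π : ProbabilityMeasure E) :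
    Integrable (fun x => Υ x y) (π : Measure E) := by
  obtain ⟨C, hC⟩ := hb
  exact .of_bound hm.aestronglyMeasurable C (ae_of_all _ hC)

theorem integral_density_pos {Υ : E → F → ℝ} {y : F} (hm : Measurable fun x => Υ x y)
    (hpos : ∀ x, 0 < Υ x y) (hb : ∃ C : ℝ, ∀ x, |Υ x y| ≤ C) (π : ProbabilityMeasure E) :
    0 < ∫ x, Υ x y ∂(π : Measure E) := by
  refine (integral_pos_iff_support_of_nonneg (fun x => (hpos x).le)
    (integrable_density hm hb π)).2 ?_
  have : Function.support (fun x => Υ x y) = Set.univ := by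
    ext x
    simp [(hpos x).ne']
  simp [this]

theorem integral_update {Υ : E → F → ℝ} {y : F} (hm : Measurable fun x => Υ x y)
    (hpos : ∀ x, 0 < Υ x y) (hb : ∃ C : ℝ, ∀ x, |Υ x y| ≤ C) (π : ProbabilityMeasure E)
    (g : E → ℝ) :
    ∫ x, g x ∂(update Υ y π : Measure E) =
      (∫ x, Υ x y ∂(π : Measure E))⁻¹ * ∫ x, Υ x y * g x ∂(π : Measure E) := by
  rw [coe_update hm hpos hb, updateMeasure, integral_smul_measure,
    integral_withDensity_eq_integral_toReal_smul hm.ennreal_ofReal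
      (ae_of_all _ fun x => ENNReal.ofReal_lt_top),
    ← ofReal_integral_eq_lintegral_ofReal (integrable_density hm hb π)
      (ae_of_all _ fun x => (hpos x).le), ENNReal.toReal_inv,
    ENNReal.toReal_ofReal (integral_density_pos hm hpos hb π).le]
  simp only [ENNReal.toReal_ofReal (hpos _).le, smul_eq_mul]

theorem continuous_update [TopologicalSpace E] [OpensMeasurableSpace E] {Υ : E → F → ℝ} {y : F}
    (hc : Continuous fun x => Υ x y) (hpos : ∀ x, 0 < Υ x y) (hb : ∃ C : ℝ, ∀ x, |Υ x y| ≤ C) :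
    Continuous (update Υ y) := by
  refine continuous_iff_continuousAt.2 fun π => ?_
  refine ProbabilityMeasure.tendsto_iff_forall_integral_tendsto.2 fun g => ?_
  simp only [integral_update hc.measurable hpos hb]
  obtain ⟨C, hC⟩ := hb
  refine Tendsto.mul (Tendsto.inv₀ ((continuous_integral_of_bounded hc hC).tendsto π)
    (integral_density_pos hc.measurable hpos ⟨C, hC⟩ π).ne') ?_
  refine (continuous_integral_of_bounded (hc.mul g.continuous) (C := C * ‖g‖) fun x => ?_).tendsto π
  rw [Pi.mul_apply, abs_mul]
  exact mul_le_mul (hC x) (g.norm_coe_le_norm x) (abs_nonneg _) ((abs_nonneg _).trans (hC x))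

end Steps

/-! ### Concentration of the empirical measures -/

section Sampling

variable {E : Type*} [MeasurableSpace E]

theorem measurable_sampling (N : ℕ+) :
    Measurable (fun ρ : ProbabilityMeasure E => sampling N ρ) := by
  refine (Measure.measurable_map _ (measurable_empirical N)).comp ?_
  refine Measurable.measure_of_isPiSystem_of_isProbabilityMeasure generateFrom_pi.symm
    isPiSystem_pi ?_
  rintro _ ⟨s, hs, rfl⟩
  simp only [Measure.pi_pi]
  exact Finset.measurable_prod _ fun i _ =>
    (Measure.measurable_coe (hs i (Set.mem_univ i))).comp measurable_subtype_coe

theorem integral_empirical {g : E → ℝ} (hg : Measurable g) (N : ℕ+) (x : Fin N → E) :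
    ∫ z, g z ∂(empirical N x : Measure E) = (N : ℝ)⁻¹ * ∑ i, g (x i) := by
  change ∫ z, g z ∂((N : ℝ≥0∞)⁻¹ • ∑ i, Measure.dirac (x i)) = _
  have hi : ∀ i ∈ Finset.univ, Integrable g (Measure.dirac (x i)) := fun i _ =>
    integrable_dirac' hg.stronglyMeasurable (by simp)
  rw [integral_smul_measure, integral_finsetSum_measure hi]
  simp [integral_dirac' _ _ hg.stronglyMeasurable]

/-- Chebyshev's inequality: the integral of `g` against the empirical measure of `N` independent
samples from `ρ` has mean `∫ g dρ` and variance `1 / N` times the variance of `g`. -/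
theorem sampling_setOf_le_abs_sub_le {g : E → ℝ} (hg : Measurable g) {C : ℝ} (hC : ∀ x, |g x| ≤ C)
    (N : ℕ+) (ρ : ProbabilityMeasure E) {ε : ℝ} (hε : 0 < ε) :
    sampling N ρ {ν | ε ≤ |∫ x, g x ∂(ν : Measure E) - ∫ x, g x ∂(ρ : Measure E)|} ≤
      ENNReal.ofReal (C ^ 2 / (N * ε ^ 2)) := by
  have hN : (0 : ℝ) < N := by exact_mod_cast N.pos
  set pr := Measure.pi (fun _ : Fin N => (ρ : Measure E)) with hpr
  have hLp : MemLp g 2 (ρ : Measure E) := MemLp.of_bound hg.aestronglyMeasurable C (ae_of_all _ hC)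
  set S : (Fin N → E) → ℝ := fun x => ∑ i, g (x i) with hS
  have hSi : ∀ i : Fin N, MemLp (fun x : Fin N → E => g (x i)) 2 pr := fun i =>
    hLp.comp_measurePreserving (measurePreserving_eval (fun _ : Fin N => (ρ : Measure E)) i)
  have hSp : MemLp S 2 pr := memLp_finsetSum _ fun i _ => hSi i
  have hmean : ∫ x, S x ∂pr = N * ∫ x, g x ∂(ρ : Measure E) := by
    rw [hS, integral_finsetSum _ fun i _ => (hSi i).integrable one_le_two]
    have : ∀ i : Fin N, ∫ x, g (x i) ∂pr = ∫ x, g x ∂(ρ : Measure E) := fun i => by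
      have h := (measurePreserving_eval (fun _ : Fin N => (ρ : Measure E)) i)
      rw [← h.map_eq, integral_map (measurable_pi_apply i).aemeasurable hg.aestronglyMeasurable]
    simp [this]
  have hvar : variance S pr ≤ N * C ^ 2 := by
    have h1 : S = ∑ i : Fin N, fun x : Fin N → E => g (x i) := by
      ext x; simp [hS]
    rw [h1, variance_sum_pi (X := fun _ => g) fun _ => hLp]
    have h2 := variance_le_sq_of_bounded (μ := (ρ : Measure E)) (X := g) (a := -C) (b := C)
      (ae_of_all _ fun x => abs_le.1 (hC x)) hg.aemeasurable
    simp only [Finset.sum_const, Finset.card_univ, Fintype.card_fin, nsmul_eq_mul]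
    refine mul_le_mul_of_nonneg_left (h2.trans (le_of_eq ?_)) hN.le
    ring
  have hmI : Measurable fun ν : ProbabilityMeasure E => ∫ x, g x ∂(ν : Measure E) :=
    (StronglyMeasurable.integral_kernel hg.stronglyMeasurable
      (κ := (⟨fun ν => (ν : Measure E), measurable_subtype_coe⟩ :
        Kernel (ProbabilityMeasure E) E))).measurable
  have hms : MeasurableSet {ν : ProbabilityMeasure E |
      ε ≤ |∫ x, g x ∂(ν : Measure E) - ∫ x, g x ∂(ρ : Measure E)|} :=
    measurableSet_le measurable_const (hmI.sub_const _).abs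
  rw [sampling, Measure.map_apply (measurable_empirical N) hms]
  have hch := meas_ge_le_variance_div_sq hSp (c := N * ε) (by positivity)
  refine (measure_mono fun x hx => ?_).trans (hch.trans (ENNReal.ofReal_le_ofReal ?_))
  · rw [Set.mem_preimage, Set.mem_ofPred_eq, integral_empirical hg] at hx
    change N * ε ≤ |S x - ∫ x, S x ∂pr|
    rw [hmean]
    have : S x - N * ∫ x, g x ∂(ρ : Measure E) =
        N * ((N : ℝ)⁻¹ * ∑ i, g (x i) - ∫ x, g x ∂(ρ : Measure E)) := by
      rw [mul_sub, mul_inv_cancel_left₀ hN.ne']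
    rw [this, abs_mul, abs_of_pos hN]
    exact mul_le_mul_of_nonneg_left hx hN.le
  · rw [div_le_div_iff₀ (by positivity) (by positivity)]
    calc variance S pr * (N * ε ^ 2) ≤ (N * C ^ 2) * (N * ε ^ 2) := by gcongr
      _ = C ^ 2 * (N * ε) ^ 2 := by ring

/-- The empirical measures concentrate at the limit of the sampled laws. The sets of asymptotically
full probability form a filter, and it converges to that limit because it does so after
integration of every bounded continuous function. -/
theorem tendsto_sampling_compl [TopologicalSpace E] [OpensMeasurableSpace E] {ι : Type*}
    {l : Filter ι} {Ns : ι → ℕ+} {ρs : ι → ProbabilityMeasure E} {ρ : ProbabilityMeasure E}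
    (hN : Tendsto Ns l atTop) (hρ : Tendsto ρs l (𝓝 ρ)) {U : Set (ProbabilityMeasure E)}
    (hU : U ∈ 𝓝 ρ) : Tendsto (fun i => sampling (Ns i) (ρs i) Uᶜ) l (𝓝 0) := by
  -- the sets need not be measurable, since measures extend to all sets as outer measures
  let 𝓕 : Filter (ProbabilityMeasure E) :=
    { sets := {U | Tendsto (fun i => sampling (Ns i) (ρs i) Uᶜ) l (𝓝 0)}
      univ_sets := by simp [tendsto_const_nhds]
      sets_of_superset := fun {U V} hU hUV =>
        tendsto_of_tendsto_of_tendsto_of_le_of_le tendsto_const_nhds hU (fun _ => zero_le)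
          fun i => measure_mono (Set.compl_subset_compl.2 hUV)
      inter_sets := fun {U V} hU hV => by
        have h : Tendsto (fun i => sampling (Ns i) (ρs i) Uᶜ + sampling (Ns i) (ρs i) Vᶜ) l
            (𝓝 0) := by simpa using hU.add hV
        refine tendsto_of_tendsto_of_tendsto_of_le_of_le tendsto_const_nhds h (fun _ => zero_le)
          fun i => ?_
        simp only [Set.compl_inter]
        exact measure_union_le _ _ }
  suffices h : Tendsto id 𝓕 (𝓝 ρ) from h hU
  refine ProbabilityMeasure.tendsto_iff_forall_integral_tendsto.2 fun g => ?_
  refine Metric.tendsto_nhds.2 fun ε hε => ?_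
  have hNr : Tendsto (fun i => ((Ns i : ℕ) : ℝ)) l atTop :=
    tendsto_natCast_atTop_atTop.comp (tendsto_PNat_val_atTop_atTop.comp hN)
  have hb : Tendsto (fun i => ENNReal.ofReal (‖g‖ ^ 2 / ((Ns i : ℕ) * (ε / 2) ^ 2))) l (𝓝 0) := by
    rw [← ENNReal.ofReal_zero]
    refine ENNReal.tendsto_ofReal (Tendsto.div_atTop tendsto_const_nhds ?_)
    exact hNr.atTop_mul_const (by positivity)
  have hg := Metric.tendsto_nhds.1
    (ProbabilityMeasure.tendsto_iff_forall_integral_tendsto.1 hρ g) (ε / 2) (by positivity)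
  refine tendsto_of_tendsto_of_tendsto_of_le_of_le' tendsto_const_nhds hb
    (Eventually.of_forall fun _ => zero_le) ?_
  filter_upwards [hg] with i hi
  refine (measure_mono fun ν hν => ?_).trans (sampling_setOf_le_abs_sub_le
    g.continuous.measurable g.norm_coe_le_norm (Ns i) (ρs i) (half_pos hε))
  have h1 : ε ≤ dist (∫ x, g x ∂(ν : Measure E)) (∫ x, g x ∂(ρ : Measure E)) := not_lt.1 hν
  have h2 := dist_triangle (∫ x, g x ∂(ν : Measure E)) (∫ x, g x ∂(ρs i : Measure E))
    (∫ x, g x ∂(ρ : Measure E))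
  change ε / 2 ≤ dist (∫ x, g x ∂(ν : Measure E)) (∫ x, g x ∂(ρs i : Measure E))
  linarith

/-- Only continuity at the limit `ρ` is required of `f`; this allows for functions such as
`ν ↦ blDist (U y ν) (U y ρ)`. -/
theorem tendsto_integral_sampling [TopologicalSpace E] [OpensMeasurableSpace E] {ι : Type*}
    {l : Filter ι} {Ns : ι → ℕ+} {ρs : ι → ProbabilityMeasure E} {ρ : ProbabilityMeasure E}
    (hN : Tendsto Ns l atTop) (hρ : Tendsto ρs l (𝓝 ρ)) {f : ProbabilityMeasure E → ℝ}
    (hf : Measurable f) {C : ℝ} (hC : ∀ ν, |f ν| ≤ C) (hfρ : ContinuousAt f ρ) :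
    Tendsto (fun i => ∫ ν, f ν ∂(sampling (Ns i) (ρs i))) l (𝓝 (f ρ)) := by
  refine Metric.tendsto_nhds.2 fun ε hε => ?_
  have hC0 : 0 ≤ C := (abs_nonneg _).trans (hC ρ)
  set U : Set (ProbabilityMeasure E) := {ν | dist (f ν) (f ρ) < ε / 2} with hU
  have hUm : MeasurableSet U := measurableSet_lt (hf.dist measurable_const) measurable_const
  have hsmall : ∀ᶠ i in l, 2 * C * (sampling (Ns i) (ρs i)).real Uᶜ < ε / 2 := by
    have h1 := (ENNReal.tendsto_toReal ENNReal.zero_ne_top).comp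
      (tendsto_sampling_compl hN hρ (Metric.tendsto_nhds.1 hfρ (ε / 2) (by positivity)))
    have h2 := h1.const_mul (2 * C)
    simp only [ENNReal.toReal_zero, mul_zero] at h2
    exact h2.eventually_lt_const (by positivity)
  filter_upwards [hsmall] with i hi
  have hs := isProbabilityMeasure_sampling (Ns i) (ρs i)
  set m := sampling (Ns i) (ρs i) with hm
  have hfi : Integrable f m := .of_bound hf.aestronglyMeasurable C (ae_of_all _ hC)
  have hle : ∀ ν, |f ν - f ρ| ≤ ε / 2 + Uᶜ.indicator (fun _ => 2 * C) ν := fun ν => by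
    by_cases h : ν ∈ U
    · have h' : |f ν - f ρ| < ε / 2 := h
      simpa [h] using h'.le
    · have h1 := abs_le.1 (hC ν)
      have h2 := abs_le.1 (hC ρ)
      rw [Set.indicator_of_mem (Set.mem_compl h)]
      exact abs_le.2 ⟨by linarith, by linarith⟩
  calc dist (∫ ν, f ν ∂m) (f ρ) = |∫ ν, (f ν - f ρ) ∂m| := by
        rw [integral_sub hfi (integrable_const _), Real.dist_eq]
        simp
    _ ≤ ∫ ν, |f ν - f ρ| ∂m := abs_integral_le_integral_abs
    _ ≤ ∫ ν, (ε / 2 + Uᶜ.indicator (fun _ => 2 * C) ν) ∂m :=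
        integral_mono (hfi.sub (integrable_const _)).abs
          ((integrable_const _).add ((integrable_const _).indicator hUm.compl)) hle
    _ = ε / 2 + 2 * C * m.real Uᶜ := by
        rw [integral_add (integrable_const _) ((integrable_const _).indicator hUm.compl),
          integral_indicator_const _ hUm.compl]
        simp [mul_comm]
    _ < ε := by linarith

end Sampling

/-! ### Convergence of the integrals of one step of the filter -/

/-- Generalized dominated convergence: the dominating functions may vary, as long as they converge
together with their integrals. -/
theorem tendsto_integral_of_tendsto_integral_bound {α ι : Type*} [MeasurableSpace α]
    {m : Measure α} {l : Filter ι} [l.IsCountablyGenerated] {J g : ι → α → ℝ} {J₀ g₀ : α → ℝ}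
    (hJm : ∀ i, AEStronglyMeasurable (J i) m) (hg : ∀ i, Integrable (g i) m)
    (hg₀ : Integrable g₀ m) (hle : ∀ i x, |J i x| ≤ g i x) (hle₀ : ∀ x, |J₀ x| ≤ g₀ x)
    (hJ : ∀ x, Tendsto (fun i => J i x) l (𝓝 (J₀ x)))
    (hgl : ∀ x, Tendsto (fun i => g i x) l (𝓝 (g₀ x)))
    (hint : Tendsto (fun i => ∫ x, g i x ∂m) l (𝓝 (∫ x, g₀ x ∂m))) :
    Tendsto (fun i => ∫ x, J i x ∂m) l (𝓝 (∫ x, J₀ x ∂m)) := by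
  have hg0 : ∀ i x, 0 ≤ g i x := fun i x => (abs_nonneg _).trans (hle i x)
  have hg₀0 : ∀ x, 0 ≤ g₀ x := fun x => (abs_nonneg _).trans (hle₀ x)
  have hJi : ∀ i, Integrable (J i) m := fun i => (hg i).mono' (hJm i) (ae_of_all _ (hle i))
  -- truncate at the level of the limiting bound; the truncation error is at most `g i - min`
  set T : ι → α → ℝ := fun i x => max (-g₀ x) (min (J i x) (g₀ x)) with hT
  set M : ι → α → ℝ := fun i x => min (g i x) (g₀ x) with hM
  have hTm : ∀ i, AEStronglyMeasurable (T i) m := fun i =>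
    hg₀.aestronglyMeasurable.neg.sup ((hJm i).inf hg₀.aestronglyMeasurable)
  have hTb : ∀ i x, |T i x| ≤ g₀ x := fun i x =>
    abs_le.2 ⟨le_max_left _ _, max_le (by linarith [hg₀0 x]) (min_le_right _ _)⟩
  have hTi : ∀ i, Integrable (T i) m := fun i => hg₀.mono' (hTm i) (ae_of_all _ (hTb i))
  have hMm : ∀ i, AEStronglyMeasurable (M i) m := fun i =>
    (hg i).aestronglyMeasurable.inf hg₀.aestronglyMeasurable
  have hMb : ∀ i x, ‖M i x‖ ≤ g₀ x := fun i x => by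
    rw [Real.norm_of_nonneg (le_min (hg0 i x) (hg₀0 x))]
    exact min_le_right _ _
  have hMi : ∀ i, Integrable (M i) m := fun i => hg₀.mono' (hMm i) (ae_of_all _ (hMb i))
  have hTlim : Tendsto (fun i => ∫ x, T i x ∂m) l (𝓝 (∫ x, J₀ x ∂m)) := by
    refine tendsto_integral_filter_of_dominated_convergence g₀ (Eventually.of_forall hTm)
      (Eventually.of_forall fun i => ae_of_all _ (hTb i)) hg₀ (ae_of_all _ fun x => ?_)
    have h := (tendsto_const_nhds (x := -g₀ x)).max
      ((hJ x).min (tendsto_const_nhds (x := g₀ x)))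
    have h1 := abs_le.1 (hle₀ x)
    rwa [min_eq_left h1.2, max_eq_right h1.1] at h
  have hMlim : Tendsto (fun i => ∫ x, M i x ∂m) l (𝓝 (∫ x, g₀ x ∂m)) := by
    refine tendsto_integral_filter_of_dominated_convergence g₀ (Eventually.of_forall hMm)
      (Eventually.of_forall fun i => ae_of_all _ (hMb i)) hg₀ (ae_of_all _ fun x => ?_)
    have h := (hgl x).min (tendsto_const_nhds (x := g₀ x))
    rwa [min_self] at h
  have herr : ∀ i x, |J i x - T i x| ≤ g i x - M i x := fun i x => by
    have h1 := abs_le.1 (hle i x)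
    have h2 := hg₀0 x
    simp only [hT, hM]
    rcases le_total (g i x) (g₀ x) with h | h
    · rw [min_eq_left h, min_eq_left (h1.2.trans h), max_eq_right (by linarith)]
      simp
    · rw [min_eq_right h]
      rcases le_total (J i x) (g₀ x) with h3 | h3
      · rw [min_eq_left h3]
        rcases le_total (-g₀ x) (J i x) with h4 | h4
        · rw [max_eq_right h4]; simpa using h
        · rw [max_eq_left h4]; exact abs_le.2 ⟨by linarith, by linarith⟩
      · rw [min_eq_right h3, max_eq_right (by linarith)]
        exact abs_le.2 ⟨by linarith, by linarith⟩
  have hdiff : Tendsto (fun i => ∫ x, J i x ∂m - ∫ x, T i x ∂m) l (𝓝 0) := by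
    have h0 := hint.sub hMlim
    rw [sub_self] at h0
    refine squeeze_zero_norm (fun i => ?_) h0
    rw [← integral_sub (hJi i) (hTi i), ← integral_sub (hg i) (hMi i)]
    exact norm_integral_le_of_norm_le ((hg i).sub (hMi i)) (ae_of_all _ (herr i))
  simpa using hdiff.add hTlim

section OneStep

variable {E F : Type*} [MeasurableSpace E] [MeasurableSpace F] {φ : Measure F} {Υ : E → F → ℝ}

theorem integral_density_eq_one {Φ : Kernel E F} [IsMarkovKernel Φ] (hnd : Nondegenerate Φ φ Υ)
    (x : E) : ∫ y, Υ x y ∂φ = 1 := by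
  have h := hnd.density x Set.univ MeasurableSet.univ
  rw [measure_univ, Measure.restrict_univ] at h
  rw [integral_eq_lintegral_of_nonneg_ae (ae_of_all _ fun y => (hnd.pos x y).le)
    (hnd.measurable.comp measurable_prodMk_left).aestronglyMeasurable, ← h]
  simp

section

variable [SigmaFinite φ]

theorem integrable_uncurry_density {Φ : Kernel E F} [IsMarkovKernel Φ]
    (hnd : Nondegenerate Φ φ Υ) (p : ProbabilityMeasure E) :
    Integrable (Function.uncurry Υ) ((p : Measure E).prod φ) := by
  have h := isProbabilityMeasure_obsMeasure hnd (p : Measure E)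
  refine ⟨hnd.measurable.aestronglyMeasurable, ?_⟩
  refine (hasFiniteIntegral_iff_ofReal (f := Function.uncurry Υ)
    (ae_of_all _ fun z => (hnd.pos z.1 z.2).le)).2 ?_
  have h1 := measure_univ (μ := obsMeasure φ Υ (p : Measure E))
  rw [obsMeasure, withDensity_apply _ MeasurableSet.univ, Measure.restrict_univ] at h1
  exact h1.trans_lt ENNReal.one_lt_top

theorem integral_integral_density {Φ : Kernel E F} [IsMarkovKernel Φ]
    (hnd : Nondegenerate Φ φ Υ) (p : ProbabilityMeasure E) :
    ∫ y, ∫ x, Υ x y ∂(p : Measure E) ∂φ = 1 := by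
  have hi := integrable_uncurry_density hnd p
  have h1 := integral_prod_symm _ hi
  rw [integral_prod _ hi] at h1
  simp only [Function.uncurry_apply_pair, integral_density_eq_one hnd] at h1
  rw [← h1]
  simp

/-- The observation is integrated last: for a fixed observation `y` the density `Υ(·, y)` is
bounded, whereas it need not be bounded jointly. -/
theorem integral_obsMeasure_prod {Φ : Kernel E F} [IsMarkovKernel Φ] (hnd : Nondegenerate Φ φ Υ)
    (hb : ∀ y, ∃ C : ℝ, ∀ x, |Υ x y| ≤ C) (p : ProbabilityMeasure E) {A : Type*}
    [MeasurableSpace A] (S : Measure A) [IsProbabilityMeasure S] {G : (E × F) × A → ℝ}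
    (hG : Measurable G) {C : ℝ} (hC : ∀ z, |G z| ≤ C) :
    ∫ z, G z ∂((obsMeasure φ Υ (p : Measure E)).prod S) =
      ∫ y, ∫ z, Υ z.1 y * G ((z.1, y), z.2) ∂((p : Measure E).prod S) ∂φ := by
  have := isProbabilityMeasure_obsMeasure hnd (p : Measure E)
  have hGi : Integrable G ((obsMeasure φ Υ (p : Measure E)).prod S) :=
    .of_bound hG.aestronglyMeasurable C (ae_of_all _ hC)
  have hK : StronglyMeasurable fun z : E × F => ∫ a, G (z, a) ∂S :=
    hG.stronglyMeasurable.integral_prod_right'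
  have hKb : ∀ z : E × F, |∫ a, G (z, a) ∂S| ≤ C := fun z => by
    simpa using norm_integral_le_of_norm_le_const (μ := S) (f := fun a => G (z, a))
      (ae_of_all _ fun a => hC (z, a))
  have hint : Integrable (fun z : E × F => Υ z.1 z.2 * ∫ a, G (z, a) ∂S)
      ((p : Measure E).prod φ) := by
    refine ((integrable_uncurry_density hnd p).mul_const C).mono'
      (hnd.measurable.aestronglyMeasurable.mul hK.aestronglyMeasurable) (ae_of_all _ fun z => ?_)
    rw [norm_mul, Real.norm_of_nonneg (hnd.pos z.1 z.2).le]
    exact mul_le_mul_of_nonneg_left (hKb z) (hnd.pos z.1 z.2).le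
  rw [integral_prod _ hGi]
  have hwd : ∫ z, ∫ a, G (z, a) ∂S ∂(obsMeasure φ Υ (p : Measure E)) =
      ∫ z : E × F, Υ z.1 z.2 * ∫ a, G (z, a) ∂S ∂((p : Measure E).prod φ) := by
    have hm : Measurable fun z : E × F => ENNReal.ofReal (Υ z.1 z.2) :=
      hnd.measurable.ennreal_ofReal
    rw [obsMeasure, integral_withDensity_eq_integral_toReal_smul hm
      (ae_of_all _ fun x => ENNReal.ofReal_lt_top)]
    simp only [ENNReal.toReal_ofReal (hnd.pos _ _).le, smul_eq_mul]
  rw [hwd]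
  rw [integral_prod_symm _ hint]
  refine integral_congr_ae (ae_of_all _ fun y => ?_)
  obtain ⟨B, hB⟩ := hb y
  have hi : Integrable (fun z : E × A => Υ z.1 y * G ((z.1, y), z.2))
      ((p : Measure E).prod S) := by
    refine .of_bound (Measurable.aestronglyMeasurable ?_) (B * C) (ae_of_all _ fun z => ?_)
    · exact (hnd.measurable.comp (measurable_fst.prodMk measurable_const)).mul
        (hG.comp ((measurable_fst.prodMk measurable_const).prodMk measurable_snd))
    · rw [norm_mul]
      exact mul_le_mul (hB _) (hC _) (abs_nonneg _) ((abs_nonneg _).trans (hB z.1))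
  change _ = ∫ z : E × A, Υ z.1 y * G ((z.1, y), z.2) ∂((p : Measure E).prod S)
  rw [integral_prod _ hi]
  refine integral_congr_ae (ae_of_all _ fun x => ?_)
  exact (integral_const_mul _ _).symm

end

theorem abs_integral_density_mul_le {Φ : Kernel E F} [IsMarkovKernel Φ]
    (hnd : Nondegenerate Φ φ Υ) (hb : ∀ y, ∃ C : ℝ, ∀ x, |Υ x y| ≤ C) (p : ProbabilityMeasure E)
    {A : Type*} [MeasurableSpace A] (S : Measure A) [IsProbabilityMeasure S] {H : E × A → ℝ}
    {C : ℝ} (hC : ∀ z, |H z| ≤ C) (y : F) :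
    |∫ z, Υ z.1 y * H z ∂((p : Measure E).prod S)| ≤ C * ∫ x, Υ x y ∂(p : Measure E) := by
  have hm := hnd.measurable.comp (measurable_prodMk_right (y := y))
  have hi := (integrable_density hm (hb y) p).comp_fst S
  have hn := norm_integral_le_of_norm_le (f := fun z : E × A => Υ z.1 y * H z)
    (hi.const_mul C) (ae_of_all _ fun z => by
      rw [norm_mul, Real.norm_of_nonneg (hnd.pos z.1 y).le, mul_comm]
      exact mul_le_mul_of_nonneg_right (hC z) (hnd.pos z.1 y).le)
  rw [Real.norm_eq_abs] at hn
  refine hn.trans_eq ?_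
  rw [integral_const_mul, integral_prod _ hi]
  simp

theorem measurable_update_comp {Φ : Kernel E F} (hnd : Nondegenerate Φ φ Υ)
    (hb : ∀ y, ∃ C : ℝ, ∀ x, |Υ x y| ≤ C) {A : Type*} {mA : MeasurableSpace A} {g : A → F}
    {h : A → ProbabilityMeasure E} (hg : Measurable g) (hh : Measurable h) :
    Measurable fun a => update Υ (g a) (h a) := by
  have hU := (measurable_update hnd.measurable hnd.pos hb).comp (hg.prodMk hh)
  exact hU

variable [TopologicalSpace E] [SecondCountableTopology E] [TopologicalSpace.PseudoMetrizableSpace E]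
  [OpensMeasurableSpace E] [SigmaFinite φ]

/-- For a fixed observation the integrand is continuous and bounded, so that the inner integrals
converge; they are dominated by the densities of the observation, which all have integral one.
No continuity of the integrand in the observation is needed. -/
theorem tendsto_integral_obsMeasure_prod {Φ : Kernel E F} [IsMarkovKernel Φ] {P : Kernel E E}
    [IsMarkovKernel P] (hnd : Nondegenerate Φ φ Υ) (hcont : ContinuousModel P Υ) {A : Type*}
    [MeasurableSpace A] [TopologicalSpace A] [SecondCountableTopology A]
    [TopologicalSpace.PseudoMetrizableSpace A] [OpensMeasurableSpace A] {G : (E × F) × A → ℝ}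
    (hG : Measurable G) {C : ℝ} (hC : ∀ z, |G z| ≤ C)
    (hGc : ∀ y, Continuous fun z : E × A => G ((z.1, y), z.2)) {ι : Type*} {l : Filter ι}
    [l.IsCountablyGenerated] {ps : ι → ProbabilityMeasure E} {p : ProbabilityMeasure E}
    {Ss : ι → ProbabilityMeasure A} {S : ProbabilityMeasure A} (hp : Tendsto ps l (𝓝 p))
    (hS : Tendsto Ss l (𝓝 S)) :
    Tendsto (fun i => ∫ z, G z ∂((obsMeasure φ Υ (ps i : Measure E)).prod (Ss i : Measure A))) l
      (𝓝 (∫ z, G z ∂((obsMeasure φ Υ (p : Measure E)).prod (S : Measure A)))) := by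
  simp only [integral_obsMeasure_prod hnd hcont.bounded_density _ _ hG hC]
  have hwint : ∀ q : ProbabilityMeasure E, ∫ y, C * ∫ x, Υ x y ∂(q : Measure E) ∂φ = C :=
    fun q => by rw [integral_const_mul, integral_integral_density hnd q, mul_one]
  have hwi : ∀ q : ProbabilityMeasure E,
      Integrable (fun y => C * ∫ x, Υ x y ∂(q : Measure E)) φ := fun q =>
    (integrable_uncurry_density hnd q).integral_prod_right.const_mul _
  have hle : ∀ (q : ProbabilityMeasure E) (T : ProbabilityMeasure A) (y : F),
      |∫ z, Υ z.1 y * G ((z.1, y), z.2) ∂((q : Measure E).prod (T : Measure A))| ≤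
        C * ∫ x, Υ x y ∂(q : Measure E) := fun q T y =>
    abs_integral_density_mul_le hnd hcont.bounded_density q (T : Measure A)
      (H := fun z => G ((z.1, y), z.2)) (fun _ => hC _) y
  refine tendsto_integral_of_tendsto_integral_bound (fun i => ?_) (fun i => hwi (ps i)) (hwi p)
    (fun i => hle (ps i) (Ss i)) (hle p S) (fun y => ?_) (fun y => ?_) ?_
  · refine StronglyMeasurable.aestronglyMeasurable ?_
    refine StronglyMeasurable.integral_prod_right (f := fun y (z : E × A) =>
      Υ z.1 y * G ((z.1, y), z.2)) (Measurable.stronglyMeasurable ?_)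
    exact (hnd.measurable.comp ((measurable_fst.comp measurable_snd).prodMk measurable_fst)).mul
      (hG.comp (((measurable_fst.comp measurable_snd).prodMk measurable_fst).prodMk
        (measurable_snd.comp measurable_snd)))
  · obtain ⟨B, hB⟩ := hcont.bounded_density y
    have hcy : Continuous fun z : E × A => Υ z.1 y * G ((z.1, y), z.2) :=
      ((hcont.continuous_density y).comp continuous_fst).mul (hGc y)
    have hbd : ∀ z : E × A, |Υ z.1 y * G ((z.1, y), z.2)| ≤ B * C := fun z => by
      rw [abs_mul]
      exact mul_le_mul (hB _) (hC _) (abs_nonneg _) ((abs_nonneg _).trans (hB z.1))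
    have hprod : Tendsto (fun i => (ps i).prod (Ss i)) l (𝓝 (p.prod S)) :=
      (ProbabilityMeasure.continuous_prod.tendsto (p, S)).comp (hp.prodMk_nhds hS)
    exact ((continuous_integral_of_bounded hcy hbd).tendsto (p.prod S)).comp hprod
  · obtain ⟨B, hB⟩ := hcont.bounded_density y
    exact (((continuous_integral_of_bounded (hcont.continuous_density y) hB).tendsto p).comp
      hp).const_mul _
  · simp only [hwint]
    exact tendsto_const_nhds

theorem tendsto_sampling_dirac {ι : Type*} {l : Filter ι} {Ns : ι → ℕ+}
    {ρs : ι → ProbabilityMeasure E} {ρ : ProbabilityMeasure E} (hN : Tendsto Ns l atTop)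
    (hρ : Tendsto ρs l (𝓝 ρ)) :
    Tendsto (β := ProbabilityMeasure (ProbabilityMeasure E))
      (fun i => ⟨sampling (Ns i) (ρs i), isProbabilityMeasure_sampling _ _⟩) l
      (𝓝 (diracProba ρ)) := by
  refine ProbabilityMeasure.tendsto_iff_forall_integral_tendsto.2 fun f => ?_
  have hf := f.continuous.measurable
  have h := tendsto_integral_sampling hN hρ hf f.norm_coe_le_norm f.continuous.continuousAt
  rw [← integral_dirac' f ρ hf.stronglyMeasurable] at h
  exact h

/-- Common form of the convergence of the transition kernels (`ps` the transition probabilities,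
`ρs` the predictions) and of the initial measures (`ps` and `ρs` constant, equal to `μ`). -/
theorem tendsto_integral_bootstrap {Φ : Kernel E F} [IsMarkovKernel Φ] {P : Kernel E E}
    [IsMarkovKernel P] (hnd : Nondegenerate Φ φ Υ) (hcont : ContinuousModel P Υ)
    (f : (E × ProbabilityMeasure E) →ᵇ ℝ) {ι : Type*} {l : Filter ι} [l.IsCountablyGenerated]
    {Ns : ι → ℕ+} {ps ρs : ι → ProbabilityMeasure E} {p ρ : ProbabilityMeasure E}
    (hN : Tendsto Ns l atTop) (hp : Tendsto ps l (𝓝 p)) (hρ : Tendsto ρs l (𝓝 ρ)) :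
    Tendsto (fun i => ∫ z, f z ∂(((obsMeasure φ Υ (ps i : Measure E)).prod
        (sampling (Ns i) (ρs i))).map (fun z => (z.1.1, update Υ z.1.2 z.2)))) l
      (𝓝 (∫ z, f z ∂((obsMeasure φ Υ (p : Measure E)).map
        (fun z => (z.1, update Υ z.2 ρ))))) := by
  have hf := f.continuous.measurable
  have hmap : Measurable fun z : (E × F) × ProbabilityMeasure E =>
      (z.1.1, update Υ z.1.2 z.2) := (measurable_fst.comp measurable_fst).prodMk
    (measurable_update_comp hnd hcont.bounded_density (measurable_snd.comp measurable_fst)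
      measurable_snd)
  have hG : Measurable fun z : (E × F) × ProbabilityMeasure E => f (z.1.1, update Υ z.1.2 z.2) :=
    hf.comp hmap
  have hC : ∀ z : (E × F) × ProbabilityMeasure E, |f (z.1.1, update Υ z.1.2 z.2)| ≤ ‖f‖ :=
    fun z => f.norm_coe_le_norm _
  have hGc : ∀ y, Continuous fun z : E × ProbabilityMeasure E => f (z.1, update Υ y z.2) :=
    fun y => f.continuous.comp (continuous_fst.prodMk
      ((continuous_update (hcont.continuous_density y) (fun x => hnd.pos x y)
        (hcont.bounded_density y)).comp continuous_snd))
  have h := tendsto_integral_obsMeasure_prod hnd hcont hG hC hGc hp (tendsto_sampling_dirac hN hρ)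
  -- the exact filter corresponds to sampling from the Dirac measure at `ρ`
  have hlim : ∫ z, f z ∂((obsMeasure φ Υ (p : Measure E)).map (fun z => (z.1, update Υ z.2 ρ))) =
      ∫ z : (E × F) × ProbabilityMeasure E, f (z.1.1, update Υ z.1.2 z.2)
        ∂((obsMeasure φ Υ (p : Measure E)).prod (Measure.dirac ρ)) := by
    have := isProbabilityMeasure_obsMeasure hnd (p : Measure E)
    have hm : Measurable fun z : E × F => (z.1, update Υ z.2 ρ) :=
      measurable_fst.prodMk (measurable_update_comp hnd hcont.bounded_density measurable_snd
        measurable_const)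
    have hGi : Integrable
        (fun z : (E × F) × ProbabilityMeasure E => f (z.1.1, update Υ z.1.2 z.2))
        ((obsMeasure φ Υ (p : Measure E)).prod (Measure.dirac ρ)) :=
      .of_bound hG.aestronglyMeasurable ‖f‖ (ae_of_all _ hC)
    rw [integral_map hm.aemeasurable hf.aestronglyMeasurable, integral_prod _ hGi]
    refine integral_congr_ae (ae_of_all _ fun z => ?_)
    exact (integral_dirac' (fun π => f (z.1, update Υ z.2 π)) ρ
      (hG.comp measurable_prodMk_left).stronglyMeasurable).symm
  rw [hlim]
  refine h.congr fun i => ?_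
  exact (integral_map hmap.aemeasurable hf.aestronglyMeasurable).symm

end OneStep

/-! ### Convergence of the bootstrap filter at a fixed time -/

/-- If `κ` is the conditional law of `Z` given `G` and `W` is `G`-measurable, then the expectation
of `f (W, Z)` is computed by integrating out `Z` with respect to `κ` first. -/
theorem integral_eq_integral_integral_of_condExp {Ω A B : Type*} {G mΩ : MeasurableSpace Ω}
    [MeasurableSpace A] [MeasurableSpace B] {Pr : Measure Ω} [IsProbabilityMeasure Pr]
    (hG : G ≤ mΩ) {Z : Ω → B} (hZ : Measurable Z) {W : Ω → A} (hW : Measurable[G] W)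
    (κ : Kernel Ω B) [IsMarkovKernel κ]
    (hκ : ∀ s, MeasurableSet s → Pr⟦Z ⁻¹' s | G⟧ =ᵐ[Pr] fun ω => (κ ω).real s)
    {f : A × B → ℝ} (hf : Measurable f) {C : ℝ} (hC : ∀ z, |f z| ≤ C) :
    ∫ ω, f (W ω, Z ω) ∂Pr = ∫ ω, ∫ z, f (W ω, z) ∂(κ ω) ∂Pr := by
  have hW' : Measurable W := hW.mono hG le_rfl
  have hWZ : Measurable fun ω => (W ω, Z ω) := hW'.prodMk hZ
  have hWs : Measurable fun p : Ω × B => (W p.1, p.2) :=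
    (hW'.comp measurable_fst).prodMk measurable_snd
  have hlaw : Pr.map (fun ω => (W ω, Z ω)) = (Pr ⊗ₘ κ).map (fun p => (W p.1, p.2)) := by
    have := Measure.isProbabilityMeasure_map hWZ.aemeasurable (μ := Pr)
    -- it is enough to compare the two laws on rectangles
    refine Measure.ext_prod fun {s t} hs ht => ?_
    rw [Measure.map_apply hWZ (hs.prod ht), Measure.map_apply hWs (hs.prod ht)]
    have hpre : (fun p : Ω × B => (W p.1, p.2)) ⁻¹' (s ×ˢ t) = (W ⁻¹' s) ×ˢ t := rfl
    have hpre' : (fun ω => (W ω, Z ω)) ⁻¹' (s ×ˢ t) = Z ⁻¹' t ∩ W ⁻¹' s :=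
      Set.inter_comm (W ⁻¹' s) (Z ⁻¹' t)
    rw [hpre, hpre', Measure.compProd_apply_prod (hW' hs) ht]
    have hint : Integrable (fun ω => (κ ω).real t) Pr :=
      .of_bound (κ.measurable_coe ht).ennreal_toReal.aestronglyMeasurable 1
        (ae_of_all _ fun ω => by
          rw [Real.norm_of_nonneg measureReal_nonneg]; exact measureReal_le_one)
    have h1 : ∫ ω in W ⁻¹' s, (κ ω).real t ∂Pr = Pr.real (Z ⁻¹' t ∩ W ⁻¹' s) := by
      rw [← setIntegral_congr_ae (hW' hs) ((hκ t ht).mono fun ω h _ => h),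
        setIntegral_condExp hG ((integrable_const _).indicator (hZ ht)) (hW hs),
        integral_indicator_const _ (hZ ht)]
      simp [measureReal_restrict_apply (hZ ht)]
    have h2 := ofReal_integral_eq_lintegral_ofReal (μ := Pr.restrict (W ⁻¹' s))
      hint.integrableOn (ae_of_all _ fun ω => measureReal_nonneg)
    rw [h1, ofReal_measureReal] at h2
    rw [h2]
    exact lintegral_congr fun ω => ofReal_measureReal
  have h1 : ∫ ω, f (W ω, Z ω) ∂Pr = ∫ z, f z ∂(Pr.map fun ω => (W ω, Z ω)) :=
    (integral_map hWZ.aemeasurable hf.aestronglyMeasurable).symm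
  rw [h1, hlaw, integral_map hWs.aemeasurable hf.aestronglyMeasurable]
  exact Measure.integral_compProd (.of_bound (hf.comp hWs).aestronglyMeasurable C
    (ae_of_all _ fun z => hC _))

section Filter

variable {E F Ω : Type*} [MeasurableSpace E] [MeasurableSpace F] {Υ : E → F → ℝ}

theorem measurable_map_sampling {U : F → ProbabilityMeasure E → ProbabilityMeasure E}
    (hU : Measurable (Function.uncurry U)) (N : ℕ+) :
    Measurable fun q : ProbabilityMeasure E × F => (sampling N q.1).map (U q.2) := by
  let κ : Kernel (ProbabilityMeasure E × F) (ProbabilityMeasure E) :=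
    ⟨fun q => sampling N q.1, (measurable_sampling N).comp measurable_fst⟩
  have : IsMarkovKernel κ := ⟨fun q => isProbabilityMeasure_sampling N q.1⟩
  have hU' : Measurable fun q : (ProbabilityMeasure E × F) × ProbabilityMeasure E =>
      U q.1.2 q.2 := hU.comp ((measurable_snd.comp measurable_fst).prodMk measurable_snd)
  refine Measure.measurable_of_measurable_coe _ fun s hs => ?_
  have h := Kernel.measurable_kernel_prodMk_left (κ := κ) (hU' hs)
  have he : ∀ q : ProbabilityMeasure E × F, (sampling N q.1).map (U q.2) s =
      κ q (Prod.mk q ⁻¹' ((fun q : (ProbabilityMeasure E × F) × ProbabilityMeasure E =>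
        U q.1.2 q.2) ⁻¹' s)) :=
    fun q => Measure.map_apply (hU.comp measurable_prodMk_left) hs
  simpa only [he] using h

theorem measurable_nonlinearFilter {Φ : Kernel E F} {φ : Measure F} (hnd : Nondegenerate Φ φ Υ)
    (hb : ∀ y, ∃ C : ℝ, ∀ x, |Υ x y| ≤ C) (μ : ProbabilityMeasure E) (P : Kernel E E)
    [IsMarkovKernel P] {G : MeasurableSpace Ω} {Y : ℕ → Ω → F} (hY : ∀ j, Measurable (Y j))
    (k : ℕ) : Measurable fun ω => nonlinearFilter μ P Υ (fun j => Y j ω) k := by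
  induction k with
  | zero => exact measurable_update_comp hnd hb (hY 0) measurable_const
  | succ k ih =>
    exact measurable_update_comp hnd hb (hY (k + 1)) ((measurable_predict P).comp ih)

end Filter

section Convergence

variable {E F Ω : Type*} [PseudoMetricSpace E] [SecondCountableTopology E] [MeasurableSpace E]
  [OpensMeasurableSpace E] [MeasurableSpace F] {mΩ : MeasurableSpace Ω} {Pr : Measure Ω}
  [IsProbabilityMeasure Pr]

theorem measurable_blDist_comp {A : Type*} {mA : MeasurableSpace A}
    {g h : A → ProbabilityMeasure E} (hg : Measurable g) (hh : Measurable h) :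
    Measurable fun a => blDist (g a) (h a) := by
  have hm := measurable_blDist.comp (hg.prodMk hh)
  exact hm

theorem integrable_blDist {g h : Ω → ProbabilityMeasure E} (hg : Measurable g)
    (hh : Measurable h) : Integrable (fun ω => blDist (g ω) (h ω)) Pr :=
  .of_bound (measurable_blDist_comp hg hh).aestronglyMeasurable 2
    (ae_of_all _ fun _ => abs_blDist_le_two _ _)

/-- Convergence in mean for `blDist` implies almost sure weak convergence along a subsequence. -/
theorem exists_seq_tendsto_ae_of_tendsto_integral_blDist {πs : ℕ → Ω → ProbabilityMeasure E}
    {π : Ω → ProbabilityMeasure E} (hπs : ∀ n, Measurable (πs n)) (hπ : Measurable π)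
    (h : Tendsto (fun n => ∫ ω, blDist (πs n ω) (π ω) ∂Pr) atTop (𝓝 0)) :
    ∃ ms : ℕ → ℕ, Tendsto ms atTop atTop ∧
      ∀ᵐ ω ∂Pr, Tendsto (fun i => πs (ms i) ω) atTop (𝓝 (π ω)) := by
  have hD : TendstoInMeasure Pr (fun n ω => blDist (πs n ω) (π ω)) atTop (fun _ => (0 : ℝ)) := by
    refine tendstoInMeasure_of_tendsto_eLpNorm one_ne_zero
      (fun n => (measurable_blDist_comp (hπs n) hπ).aestronglyMeasurable)
      aestronglyMeasurable_const ?_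
    have he : ∀ n, eLpNorm ((fun ω => blDist (πs n ω) (π ω)) - fun _ => (0 : ℝ)) 1 Pr =
        ENNReal.ofReal (∫ ω, blDist (πs n ω) (π ω) ∂Pr) := fun n => by
      rw [eLpNorm_one_eq_lintegral_enorm, ofReal_integral_eq_lintegral_ofReal
        (integrable_blDist (hπs n) hπ) (ae_of_all _ fun ω => blDist_nonneg _ _)]
      refine lintegral_congr fun ω => ?_
      simp [Real.enorm_of_nonneg (blDist_nonneg _ _)]
    simp only [he]
    simpa using ENNReal.tendsto_ofReal h
  obtain ⟨ms, hms, hae⟩ := hD.exists_seq_tendsto_ae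
  exact ⟨ms, hms.tendsto_atTop, hae.mono fun ω hω => tendsto_of_tendsto_blDist hω⟩

/-- One sampling and update step preserves convergence to the exact recursion, because the map `U y`
is continuous and the sampling laws concentrate at the limit of the sampled measures. -/
theorem tendsto_integral_blDist_resample {U : F → ProbabilityMeasure E → ProbabilityMeasure E}
    (hU : Measurable (Function.uncurry U)) (hUc : ∀ y, Continuous (U y))
    {G : ℕ+ → MeasurableSpace Ω} (hG : ∀ N, G N ≤ mΩ) {Y : Ω → F} (hY : Measurable Y)
    {ρs : ℕ+ → Ω → ProbabilityMeasure E} (hρs : ∀ N, Measurable (ρs N))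
    {ρ : Ω → ProbabilityMeasure E} (hρ : ∀ N, Measurable[G N] fun ω => U (Y ω) (ρ ω))
    {Z : ℕ+ → Ω → ProbabilityMeasure E} (hZ : ∀ N, Measurable (Z N))
    (hlaw : ∀ N s, MeasurableSet s → Pr⟦Z N ⁻¹' s | G N⟧ =ᵐ[Pr]
      fun ω => ((sampling N (ρs N ω)).map (U (Y ω))).real s)
    (hconv : ∀ ns : ℕ → ℕ+, Tendsto ns atTop atTop → ∃ ms : ℕ → ℕ, Tendsto ms atTop atTop ∧
      ∀ᵐ ω ∂Pr, Tendsto (fun i => ρs (ns (ms i)) ω) atTop (𝓝 (ρ ω))) :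
    Tendsto (fun N => ∫ ω, blDist (Z N ω) (U (Y ω) (ρ ω)) ∂Pr) atTop (𝓝 0) := by
  have hUy : ∀ y, Measurable (U y) := fun y =>
    hU.comp measurable_prodMk_left
  let κ : ℕ+ → Kernel Ω (ProbabilityMeasure E) := fun N =>
    ⟨fun ω => (sampling N (ρs N ω)).map (U (Y ω)),
      (measurable_map_sampling hU N).comp ((hρs N).prodMk hY)⟩
  have hκ : ∀ N, IsMarkovKernel (κ N) := fun N => ⟨fun ω => by
    have := isProbabilityMeasure_sampling N (ρs N ω)
    exact Measure.isProbabilityMeasure_map (hUy (Y ω)).aemeasurable⟩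
  set W : Ω → ProbabilityMeasure E := fun ω => U (Y ω) (ρ ω) with hW
  have hWm : Measurable W := (hρ 1).mono (hG 1) le_rfl
  have hDsw : Measurable fun p : ProbabilityMeasure E × ProbabilityMeasure E => blDist p.2 p.1 :=
    measurable_blDist_comp measurable_snd measurable_fst
  have hstep : ∀ N, ∫ ω, blDist (Z N ω) (W ω) ∂Pr =
      ∫ ω, ∫ z, blDist z (W ω) ∂(κ N ω) ∂Pr := fun N =>
    integral_eq_integral_integral_of_condExp (hG N) (hZ N) (hρ N) (κ N) (hlaw N) hDsw
      (fun _ => abs_blDist_le_two _ _)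
  have hinner : ∀ N ω, ∫ z, blDist z (W ω) ∂(κ N ω) =
      ∫ ν, blDist (U (Y ω) ν) (W ω) ∂(sampling N (ρs N ω)) := fun N ω =>
    integral_map (hUy (Y ω)).aemeasurable
      (measurable_blDist_comp measurable_id measurable_const).aestronglyMeasurable
  -- along a subsequence on which `ρs` converges almost surely, dominated convergence applies
  refine tendsto_of_subseq_tendsto fun ns hns => ?_
  obtain ⟨ms, hms, hae⟩ := hconv ns hns
  refine ⟨ms, ?_⟩
  refine Tendsto.congr (fun i => (hstep (ns (ms i))).symm) ?_
  have h0 : ∫ ω, (0 : ℝ) ∂Pr = 0 := integral_zero _ _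
  rw [← h0]
  refine tendsto_integral_filter_of_dominated_convergence (fun _ => (2 : ℝ))
    (Eventually.of_forall fun i => ?_) (Eventually.of_forall fun i => ae_of_all _ fun ω => ?_)
    (integrable_const _) ?_
  · refine StronglyMeasurable.aestronglyMeasurable ?_
    refine StronglyMeasurable.integral_kernel_prod_right (κ := κ (ns (ms i)))
      (f := fun ω z => blDist z (W ω)) (Measurable.stronglyMeasurable ?_)
    exact measurable_blDist_comp measurable_snd (hWm.comp measurable_fst)
  · simpa using norm_integral_le_of_norm_le_const (μ := κ (ns (ms i)) ω)
      (f := fun z => blDist z (W ω)) (ae_of_all _ fun z => abs_blDist_le_two z (W ω))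
  · filter_upwards [hae] with ω hω
    simp only [hinner]
    have hc : ContinuousAt (fun ν => blDist (U (Y ω) ν) (W ω)) (ρ ω) := by
      have h1 := tendsto_blDist_of_tendsto ((hUc (Y ω)).tendsto (ρ ω))
      rw [← blDist_self (W ω)] at h1
      exact h1
    have h2 := tendsto_integral_sampling (hns.comp hms) hω
      (measurable_blDist_comp (hUy (Y ω)) measurable_const) (fun _ => abs_blDist_le_two _ _) hc
    have h3 : blDist (U (Y ω) (ρ ω)) (W ω) = 0 := blDist_self (W ω)
    rw [h3] at h2
    exact h2

/-- The σ-algebra generated by the processes `X` and `Y`. -/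
abbrev generatedBy (X : ℕ → Ω → E) (Y : ℕ → Ω → F) : MeasurableSpace Ω :=
  ⨆ j, (MeasurableSpace.comap (X j) inferInstance ⊔ MeasurableSpace.comap (Y j) inferInstance)

/-- Convergence in mean at time `k` gives almost sure weak convergence along subsequences, which the
Feller property transfers to the predictions; the resampling step turns this into convergence in
mean at time `k + 1`. -/
theorem tendsto_integral_blDist_bootstrap {Υ : E → F → ℝ} {Φ : Kernel E F} {φ : Measure F}
    (hnd : Nondegenerate Φ φ Υ) {P : Kernel E E} [IsMarkovKernel P] (hcont : ContinuousModel P Υ)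
    {μ : ProbabilityMeasure E} {X : ℕ → Ω → E} {Y : ℕ → Ω → F} (hX : ∀ j, Measurable (X j))
    (hY : ∀ j, Measurable (Y j)) {π : ℕ+ → ℕ → Ω → ProbabilityMeasure E}
    (hπ : ∀ N, IsBootstrapFilter Pr μ P Υ X Y N (π N)) (k : ℕ) :
    Tendsto (fun N => ∫ ω, blDist (π N k ω) (nonlinearFilter μ P Υ (fun j => Y j ω) k) ∂Pr)
      atTop (𝓝 0) := by
  have hle : generatedBy X Y ≤ mΩ := iSup_le fun j => sup_le (hX j).comap_le (hY j).comap_le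
  have hYg : ∀ j, Measurable[generatedBy X Y] (Y j) := fun j => measurable_iff_comap_le.2
    (le_sup_right.trans (le_iSup (fun j => MeasurableSpace.comap (X j) inferInstance ⊔
      MeasurableSpace.comap (Y j) inferInstance) j))
  have hfilt := measurable_nonlinearFilter hnd hcont.bounded_density μ P hYg
  have hU := measurable_update hnd.measurable hnd.pos hcont.bounded_density
  have hUc := fun y => continuous_update (hcont.continuous_density y) (fun x => hnd.pos x y)
    (hcont.bounded_density y)
  induction k with
  | zero =>
    exact tendsto_integral_blDist_resample hU hUc (G := fun _ => generatedBy X Y)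
      (fun _ => hle) (hY 0) (ρs := fun _ _ => μ) (fun _ => measurable_const)
      (ρ := fun _ => μ) (fun _ => hfilt 0)
      (fun N => (hπ N).measurable 0) (fun N => (hπ N).init)
      fun ns _ => ⟨id, tendsto_id, ae_of_all _ fun _ => tendsto_const_nhds⟩
  | succ k ih =>
    refine tendsto_integral_blDist_resample hU hUc
      (G := fun N => generatedBy X Y ⊔
        ⨆ j ∈ Finset.range (k + 1), MeasurableSpace.comap (π N j) inferInstance)
      (fun N => sup_le hle (iSup₂_le fun j _ => ((hπ N).measurable j).comap_le)) (hY (k + 1))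
      (ρs := fun N ω => predict P (π N k ω))
      (fun N => (measurable_predict P).comp ((hπ N).measurable k))
      (ρ := fun ω => predict P (nonlinearFilter μ P Υ (fun j => Y j ω) k))
      (fun N => (hfilt (k + 1)).mono le_sup_left le_rfl)
      (fun N => (hπ N).measurable (k + 1)) (fun N => (hπ N).step k) fun ns hns => ?_
    obtain ⟨ms, hms, hae⟩ := exists_seq_tendsto_ae_of_tendsto_integral_blDist
      (fun n => (hπ (ns n)).measurable k) ((hfilt k).mono hle le_rfl) (ih.comp hns)
    exact ⟨ms, hms, hae.mono fun ω hω =>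
      ((continuous_predict hcont.feller).tendsto _).comp hω⟩

end Convergence

end ParticleFilter

theorem mainTheorem5
    {E : Type*} [MetricSpace E] [PolishSpace E] [MeasurableSpace E] [BorelSpace E]
    {F : Type*} [TopologicalSpace F] [PolishSpace F] [MeasurableSpace F] [BorelSpace F]
    (P : Kernel E E) [IsMarkovKernel P] (Φ : Kernel E F) [IsMarkovKernel Φ]
    (μ : ProbabilityMeasure E) (φ : Measure F) [SigmaFinite φ] (Υ : E → F → ℝ)
    (hnd : ParticleFilter.Nondegenerate Φ φ Υ) (hcont : ParticleFilter.ContinuousModel P Υ) :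
    -- one step convergence of the kernels
    (∀ (f : (E × ProbabilityMeasure E) →ᵇ ℝ) (x : E) (xs : ℕ+ → E)
        (ν : ProbabilityMeasure E) (νs : ℕ+ → ProbabilityMeasure E),
      Tendsto xs atTop (𝓝 x) → Tendsto νs atTop (𝓝 ν) →
      Tendsto (fun N => ∫ z, f z ∂(ParticleFilter.bootstrapKernel P φ Υ N (xs N) (νs N))) atTop
        (𝓝 (∫ z, f z ∂(ParticleFilter.exactKernel P φ Υ x ν)))) ∧
    -- weak convergence of the initial measures
    (∀ f : (E × ProbabilityMeasure E) →ᵇ ℝ,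
      Tendsto (fun N => ∫ z, f z ∂(ParticleFilter.bootstrapInit μ φ Υ N)) atTop
        (𝓝 (∫ z, f z ∂(ParticleFilter.exactInit μ φ Υ)))) ∧
    -- convergence of the bootstrap particle filter to the nonlinear filter at every fixed time
    (∀ {Ω : Type*} [MeasurableSpace Ω] (Pr : Measure Ω) [IsProbabilityMeasure Pr]
        (X : ℕ → Ω → E) (Y : ℕ → Ω → F) (π : ℕ+ → ℕ → Ω → ProbabilityMeasure E),
      ParticleFilter.IsHiddenMarkovModel Pr μ P Φ X Y →
      (∀ N, ParticleFilter.IsBootstrapFilter Pr μ P Υ X Y N (π N)) →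
      ∀ k : ℕ,
        (∀ N, Integrable (fun ω => ParticleFilter.blDist (π N k ω)
          (ParticleFilter.nonlinearFilter μ P Υ (fun j => Y j ω) k)) Pr) ∧
        Tendsto (fun N => ∫ ω, ParticleFilter.blDist (π N k ω)
          (ParticleFilter.nonlinearFilter μ P Υ (fun j => Y j ω) k) ∂Pr) atTop (𝓝 0)) := by
  refine ⟨fun f x xs ν νs hx hν => ?_, fun f => ?_, ?_⟩
  · exact ParticleFilter.tendsto_integral_bootstrap hnd hcont f
      (ps := fun N => ParticleFilter.transition P (xs N)) (p := ParticleFilter.transition P x)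
      (ρs := fun N => ParticleFilter.predict P (νs N)) (ρ := ParticleFilter.predict P ν)
      (Ns := fun N => N) tendsto_id ((hcont.feller.tendsto x).comp hx)
      (((ParticleFilter.continuous_predict hcont.feller).tendsto ν).comp hν)
  · exact ParticleFilter.tendsto_integral_bootstrap hnd hcont f (ps := fun _ => μ) (p := μ)
      (ρs := fun _ => μ) (ρ := μ) (Ns := fun N => N) tendsto_id tendsto_const_nhds
      tendsto_const_nhds
  · intro Ω _ Pr _ X Y π hXY hπ k
    exact ⟨fun N => ParticleFilter.integrable_blDist ((hπ N).measurable k)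
        (ParticleFilter.measurable_nonlinearFilter hnd hcont.bounded_density μ P
          hXY.measurable_obs k),
      ParticleFilter.tendsto_integral_blDist_bootstrap hnd hcont hXY.measurable_signal
        hXY.measurable_obs hπ k⟩
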